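/- **Regression theorem for temporal basic action theories.** *Language.* Consider the situation calculus with sorts object, action, real (time points and physical quantities) and situation. Symbols: a constant $S_0$ and $do(a,s)$ for situations; $time(a)$ and $start(s)$ of sort real; the order $\sqsubset$ on situations; $Poss(a,s)$; static functions (with values of sort object or real) and static predicates; symbols for operations and relations on the reals; action functions $A(\bar x,t)$ with a time argument $t$; atemporal relational fluents $F(\bar x,s)$ and functional fluents $g(\bar x,s)$; finitely many real-valued temporal functional fluents $f(\bar x,t,s)$, and for each of them an atemporal functional fluent $f_{init}(\bar x,s)$. The only function symbols with values of sort situation are $S_0$ and $do$, and the only situation arguments are those shown. In all structures the sort real is $\mathbb R$ and the real operations and relations are standard; the other sorts are arbitrary non-empty sets. A formula is *uniform in* $\sigma$ (a situation variable or $S_0$) if it has no situation term other than $\sigma$, no $Poss$, no $\sqsubset$, no equality between situations and no quantifier over situations. *Theory.* A temporal basic action theory is $\mathcal D=\Sigma\cup\mathcal D_{ap}\cup\mathcal D_{ss}\cup\mathcal D_{se}\cup\mathcal D_{una}\cup\mathcal D_{S_0}$, where $\Sigma$ consists of the foundational axioms ($do$ is injective, second-order induction on situations, $\neg\, s\sqsubset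 S_0$, $s\sqsubset do(a,s')\leftrightarrow s\sqsubset s'\vee s=s'$, $start(do(a,s))=time(a)$); $\mathcal D_{ap}$ has an axiom $Poss(A(\bar x,t),s)\leftrightarrow\Pi_A(\bar x,t,s)$ for each action function; $\mathcal D_{ss}$ has a successor state axiom $F(\bar x,do(a,s))\leftrightarrow\Phi_F(\bar x,a,s)$, respectively $g(\bar x,do(a,s))=y\leftrightarrow\phi_g(\bar x,y,a,s)$, for each atemporal fluent, including every $f_{init}$; $\mathcal D_{se}$ has a state evolution axiom $f(\bar x,t,s)=y\leftrightarrow\psi_f(\bar x,t,y,s)$ for each temporal fluent; all right-hand sides are uniform in $s$, with only the displayed free variables; $\mathcal D_{una}$ are the unique name axioms for actions; $\mathcal D_{S_0}$ is a set of sentences uniform in $S_0$ which contains $time(A(\bar x,t))=t$ for each action function $A$. It is required that $\mathcal D_{una}\cup\mathcal D_{S_0}$ entails, for all $\bar x,a,t,s$: there is exactly one $y$ with $\phi_g(\bar x,y,a,s)$ (for each atemporal functional fluent $g$); there is exactly one $y$ with $\psi_f(\bar x,t,y,s)$, and $\psi_f(\bar x,start(s),f_{init}(\bar x,s),s)$ holds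 (for each temporal fluent $f$); and, for each temporal fluent $f$ that occurs in $\mathcal D_{S_0}$ (if any), the instance $\forall\bar x,t,y\,(f(\bar x,t,S_0)=y\leftrightarrow\psi_f(\bar x,t,y,S_0))$ of its state evolution axiom. $\mathcal D$ is *stratified* if there are no temporal fluents $f_1\succ f_2\succ\dots\succ f_n\succ f_1$, where $f\succ f'$ means that $f'$ occurs in $\psi_f$. *Regression.* A formula is *regressable* if each of its situation terms has the form $do([\alpha_1,\dots,\alpha_n],S_0)$, $n\ge 0$, each of its $Poss$ atoms has the form $Poss(A(\bar t,\tau),\sigma)$, and it has no $\sqsubset$, no equality between situations and no quantifier over situations. The operator $\mathcal R$ commutes with $\neg,\wedge,\exists$. On atoms $W$: 1. $\mathcal R[W]=W$ if $W$ is uniform in $S_0$ and has no temporal fluent; 2. $\mathcal R[Poss(A(\bar t,\tau),\sigma)]=\mathcal R[\Pi_A(\bar t,\tau,\sigma)]$; 3. $\mathcal R[F(\bar t,do(\alpha,\sigma))]=\mathcal R[\Phi_F(\bar t,\alpha,\sigma)]$; 4. if $W$ is not a $Poss$ atom and mentions an atemporal functional fluent term $u=g(\bar t,do(\alpha,\sigma))$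 such that $\bar t$ and all action arguments in $do(\alpha,\sigma)$ are uniform in $S_0$, then $\mathcal R[W]=\mathcal R[\exists y\,(\phi_g(\bar t,y,\alpha,\sigma)\wedge W|^{u}_{y})]$; 5. if $W$ is not a $Poss$ atom and mentions a temporal fluent term $u=f(\bar t,\tau,\sigma)$, then $\mathcal R[W]=\mathcal R[\exists y\,((\tau=start(\sigma)\wedge y=f_{init}(\bar t,\sigma)\;\vee\;\tau\ne start(\sigma)\wedge\psi_f(\bar t,\tau,y,\sigma))\wedge W|^{u}_{y})]$; 6. if $W$ is not a $Poss$ atom and mentions $u=start(do(\alpha,\sigma))$, then $\mathcal R[W]=\mathcal R[W|^{u}_{time(\alpha)}]$. Here $y$ is a new variable, and $W|^u_v$ is $W$ with $v$ in place of all occurrences of $u$. Where several rules or terms $u$ apply, any of them may be chosen; "$\mathcal R[W]$" stands for any formula that is obtained in finitely many steps. **Theorem.** Let $\mathcal D$ be a stratified temporal basic action theory and $W$ a regressable sentence. Then $\mathcal R[W]$ exists, and every such $\mathcal R[W]$ is uniform in $S_0$, mentions no temporal fluent, and satisfies $$\mathcal D\models W\quad\text{iff}\quad \mathcal D_{S_0}\cup\mathcal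 D_{una}\models\mathcal R[W].$$ So second-order projection reduces to entailment of a first-order sentence about the initial situation. -/

import Mathlib

/-! # A many-sorted situation calculus with real time, and regression

Formulas are intrinsically sorted and scoped: a context is the list of sorts of the variables that
are free, a variable is a position in that list, and a quantifier puts a new variable at the head of
the list.  Hence bound variables never clash and no renaming is needed. -/

namespace SitCalc

/-- Sorts.  `real` is the sort of time points and of physical quantities. -/
inductive Srt : Type
  | obj | act | real | sit

/-- Variables of sort `s` in the context `Γ`. -/
inductive Var : List Srt → Srt → Type
  | zero {s : Srt} {Γ : List Srt} : Var (s :: Γ) s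
  | succ {s s' : Srt} {Γ : List Srt} (v : Var Γ s) : Var (s' :: Γ) s

/-- Sort-respecting assignments to the variables of `Γ`.  They serve as environments, as
substitutions, and as argument tuples of the symbols whose list of argument sorts is `Γ`. -/
abbrev Asg (X : Srt → Type) (Γ : List Srt) : Type := ∀ s, Var Γ s → X s

/-- The empty assignment. -/
def Asg.nil {X : Srt → Type} : Asg X [] := fun _ v => nomatch v

/-- Extension of an assignment by a value for the head variable. -/
def Asg.cons {X : Srt → Type} {Γ : List Srt} {s : Srt} (x : X s) (ρ : Asg X Γ) : Asg X (s :: Γ)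
  | _, .zero => x
  | _, .succ v => ρ _ v

/-- The domain-specific vocabulary.  The situation argument of a fluent, the time argument of an
action and the time argument of a temporal fluent are not listed among the arguments. -/
structure Signature where
  /-- static (situation-independent) functions, by sort of the value -/
  Fn : Srt → Type
  fnArgs : ∀ {s}, Fn s → List Srt
  fn_sort : ∀ {s}, Fn s → s = .obj ∨ s = .real
  fn_noSit : ∀ {s} (f : Fn s), Srt.sit ∉ fnArgs f
  /-- symbols for operations on the reals, with their standard meaning (constants, `+`, `·`, …) -/
  RFn : Type
  rfnArity : RFn → ℕ
  rfnVal : ∀ f, (Fin (rfnArity f) → ℝ) → ℝ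
  /-- static predicates -/
  Pred : Type
  predArgs : Pred → List Srt
  pred_noSit : ∀ P, Srt.sit ∉ predArgs P
  /-- symbols for relations on the reals, with their standard meaning (`<`, `≤`, …) -/
  RRel : Type
  rrelArity : RRel → ℕ
  rrelVal : ∀ R, (Fin (rrelArity R) → ℝ) → Prop
  /-- action functions -/
  Act : Type
  actArgs : Act → List Srt
  act_noSit : ∀ A, Srt.sit ∉ actArgs A
  /-- atemporal relational fluents -/
  RelFl : Type
  relArgs : RelFl → List Srt
  rel_noSit : ∀ F, Srt.sit ∉ relArgs F
  /-- atemporal functional fluents, by sort of the value, other than the fluents `f_init` -/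
  OrdFl : Srt → Type
  ordArgs : ∀ {s}, OrdFl s → List Srt
  ord_sort : ∀ {s}, OrdFl s → s ≠ .sit
  ord_noSit : ∀ {s} (f : OrdFl s), Srt.sit ∉ ordArgs f
  /-- temporal functional fluents, all real-valued -/
  TempFl : Type
  tempArgs : TempFl → List Srt
  temp_noSit : ∀ f, Srt.sit ∉ tempArgs f

variable {L : Signature}

/-- Atemporal functional fluents: the ordinary ones, and `f_init` for each temporal fluent `f`. -/
inductive FunFl (L : Signature) : Srt → Type
  | ord {s : Srt} (f : L.OrdFl s) : FunFl L s
  | init (f : L.TempFl) : FunFl L .real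

/-- Sorts of the non-situation arguments of a functional fluent. -/
def FunFl.args : ∀ {s}, FunFl L s → List Srt
  | _, .ord f => L.ordArgs f
  | _, .init f => L.tempArgs f

/-! ### Terms and formulas -/

/-- Terms of each sort with free variables in `Γ`. -/
inductive Term (L : Signature) (Γ : List Srt) : Srt → Type
  | var {s : Srt} (v : Var Γ s) : Term L Γ s
  | fn {s : Srt} (f : L.Fn s) (ts : ∀ s', Var (L.fnArgs f) s' → Term L Γ s') : Term L Γ s
  | rfn (f : L.RFn) (ts : Fin (L.rfnArity f) → Term L Γ .real) : Term L Γ .real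
  | action (A : L.Act) (ts : ∀ s', Var (L.actArgs A) s' → Term L Γ s') (τ : Term L Γ .real) :
      Term L Γ .act
  | fl {s : Srt} (f : FunFl L s) (ts : ∀ s', Var f.args s' → Term L Γ s') (σ : Term L Γ .sit) :
      Term L Γ s
  | temp (f : L.TempFl) (ts : ∀ s', Var (L.tempArgs f) s' → Term L Γ s') (τ : Term L Γ .real)
      (σ : Term L Γ .sit) : Term L Γ .real
  | time (α : Term L Γ .act) : Term L Γ .real
  | start (σ : Term L Γ .sit) : Term L Γ .real
  | S0 : Term L Γ .sit
  | doAct (α : Term L Γ .act) (σ : Term L Γ .sit) : Term L Γ .sit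

/-- Atomic formulas; `prec` is the strict order `⊏` on situations. -/
inductive Atom (L : Signature) (Γ : List Srt) : Type
  | eq {s : Srt} (t u : Term L Γ s) : Atom L Γ
  | pred (P : L.Pred) (ts : Asg (Term L Γ) (L.predArgs P)) : Atom L Γ
  | rrel (R : L.RRel) (ts : Fin (L.rrelArity R) → Term L Γ .real) : Atom L Γ
  | rel (F : L.RelFl) (ts : Asg (Term L Γ) (L.relArgs F)) (σ : Term L Γ .sit) : Atom L Γ
  | poss (α : Term L Γ .act) (σ : Term L Γ .sit) : Atom L Γ
  | prec (σ σ' : Term L Γ .sit) : Atom L Γ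

/-- First-order formulas of the situation calculus with free variables in the context. -/
inductive Fml (L : Signature) : List Srt → Type
  | atom {Γ : List Srt} (a : Atom L Γ) : Fml L Γ
  | neg {Γ : List Srt} (φ : Fml L Γ) : Fml L Γ
  | and {Γ : List Srt} (φ ψ : Fml L Γ) : Fml L Γ
  | ex {Γ : List Srt} (s : Srt) (φ : Fml L (s :: Γ)) : Fml L Γ

/-- Disjunction. -/
def Fml.or {Γ : List Srt} (φ ψ : Fml L Γ) : Fml L Γ := .neg (.and (.neg φ) (.neg ψ))

/-- Equality as a formula. -/
def Fml.eq {Γ : List Srt} {s : Srt} (t u : Term L Γ s) : Fml L Γ := .atom (.eq t u)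

/-- Sentences: formulas without free variables. -/
abbrev Sentence (L : Signature) : Type := Fml L []

/-! ### Substitution -/

/-- Simultaneous substitution in terms. -/
def Term.subst {Γ Δ : List Srt} (θ : Asg (Term L Δ) Γ) : ∀ {s}, Term L Γ s → Term L Δ s
  | _, .var v => θ _ v
  | _, .fn f ts => .fn f fun s v => (ts s v).subst θ
  | _, .rfn f ts => .rfn f fun i => (ts i).subst θ
  | _, .action A ts τ => .action A (fun s v => (ts s v).subst θ) (τ.subst θ)
  | _, .fl f ts σ => .fl f (fun s v => (ts s v).subst θ) (σ.subst θ)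
  | _, .temp f ts τ σ => .temp f (fun s v => (ts s v).subst θ) (τ.subst θ) (σ.subst θ)
  | _, .time α => .time (α.subst θ)
  | _, .start σ => .start (σ.subst θ)
  | _, .S0 => .S0
  | _, .doAct α σ => .doAct (α.subst θ) (σ.subst θ)

/-- Simultaneous substitution in atoms. -/
def Atom.subst {Γ Δ : List Srt} (θ : Asg (Term L Δ) Γ) : Atom L Γ → Atom L Δ
  | .eq t u => .eq (t.subst θ) (u.subst θ)
  | .pred P ts => .pred P fun s v => (ts s v).subst θ
  | .rrel R ts => .rrel R fun i => (ts i).subst θ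
  | .rel F ts σ => .rel F (fun s v => (ts s v).subst θ) (σ.subst θ)
  | .poss α σ => .poss (α.subst θ) (σ.subst θ)
  | .prec σ σ' => .prec (σ.subst θ) (σ'.subst θ)

/-- The substitution that shifts all variables past a new head variable. -/
def shift (L : Signature) (Γ : List Srt) (s : Srt) : Asg (Term L (s :: Γ)) Γ :=
  fun _ v => .var v.succ

/-- A term in the context extended by a new variable. -/
def Term.wk {Γ : List Srt} {s s' : Srt} (t : Term L Γ s) : Term L (s' :: Γ) s :=
  t.subst (shift L Γ s')

/-- An atom in the context extended by a new variable. -/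
def Atom.wk {Γ : List Srt} {s' : Srt} (a : Atom L Γ) : Atom L (s' :: Γ) :=
  a.subst (shift L Γ s')

/-- The head variable of a context. -/
def hd {Γ : List Srt} {s : Srt} : Term L (s :: Γ) s := .var .zero

/-- Simultaneous (capture-avoiding) substitution in formulas. -/
def Fml.subst : ∀ {Γ Δ : List Srt}, Asg (Term L Δ) Γ → Fml L Γ → Fml L Δ
  | _, _, θ, .atom a => .atom (a.subst θ)
  | _, _, θ, .neg φ => .neg (φ.subst θ)
  | _, _, θ, .and φ ψ => .and (φ.subst θ) (ψ.subst θ)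
  | _, _, θ, .ex s φ => .ex s (φ.subst (Asg.cons hd fun _ v => (θ _ v).wk))

/-- `x` is the same term as `t`. -/
def Term.Same {Γ : List Srt} {s s' : Srt} (t : Term L Γ s) (x : Term L Γ s') : Prop :=
  ∃ e : s = s', e ▸ t = x

open Classical in
/-- `u` if `x` is the term `t`, and `y` otherwise. -/
noncomputable def Term.ifSame {Γ : List Srt} {s s' : Srt} (t u : Term L Γ s) (x y : Term L Γ s') :
    Term L Γ s' :=
  if h : t.Same x then h.fst ▸ u else y

/-- Replacement of all occurrences of the term `t` by the term `u` in a term. -/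
noncomputable def Term.repl {Γ : List Srt} {s₀ : Srt} (t u : Term L Γ s₀) :
    ∀ {s}, Term L Γ s → Term L Γ s
  | _, .var v => ifSame t u (.var v) (.var v)
  | _, .fn f ts => ifSame t u (.fn f ts) (.fn f fun s v => repl t u (ts s v))
  | _, .rfn f ts => ifSame t u (.rfn f ts) (.rfn f fun i => repl t u (ts i))
  | _, .action A ts τ =>
      ifSame t u (.action A ts τ) (.action A (fun s v => repl t u (ts s v)) (repl t u τ))
  | _, .fl f ts σ => ifSame t u (.fl f ts σ) (.fl f (fun s v => repl t u (ts s v)) (repl t u σ))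
  | _, .temp f ts τ σ =>
      ifSame t u (.temp f ts τ σ)
        (.temp f (fun s v => repl t u (ts s v)) (repl t u τ) (repl t u σ))
  | _, .time α => ifSame t u (.time α) (.time (repl t u α))
  | _, .start σ => ifSame t u (.start σ) (.start (repl t u σ))
  | _, .S0 => ifSame t u .S0 .S0
  | _, .doAct α σ => ifSame t u (.doAct α σ) (.doAct (repl t u α) (repl t u σ))

/-- Replacement of all occurrences of the term `t` by the term `u` in an atom. -/
noncomputable def Atom.repl {Γ : List Srt} {s₀ : Srt} (t u : Term L Γ s₀) : Atom L Γ → Atom L Γ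
  | .eq x y => .eq (Term.repl t u x) (Term.repl t u y)
  | .pred P ts => .pred P fun s v => Term.repl t u (ts s v)
  | .rrel R ts => .rrel R fun i => Term.repl t u (ts i)
  | .rel F ts σ => .rel F (fun s v => Term.repl t u (ts s v)) (Term.repl t u σ)
  | .poss α σ => .poss (Term.repl t u α) (Term.repl t u σ)
  | .prec σ σ' => .prec (Term.repl t u σ) (Term.repl t u σ')

/-! ### Syntactic classes -/

/-- Some subterm of the term has the property `p`. -/
def Term.Mentions {Γ : List Srt} (p : ∀ s, Term L Γ s → Prop) : ∀ {s}, Term L Γ s → Prop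
  | _, .var v => p _ (.var v)
  | _, .fn f ts => p _ (.fn f ts) ∨ ∃ s v, (ts s v).Mentions p
  | _, .rfn f ts => p _ (.rfn f ts) ∨ ∃ i, (ts i).Mentions p
  | _, .action A ts τ => p _ (.action A ts τ) ∨ (∃ s v, (ts s v).Mentions p) ∨ τ.Mentions p
  | _, .fl f ts σ => p _ (.fl f ts σ) ∨ (∃ s v, (ts s v).Mentions p) ∨ σ.Mentions p
  | _, .temp f ts τ σ =>
      p _ (.temp f ts τ σ) ∨ (∃ s v, (ts s v).Mentions p) ∨ τ.Mentions p ∨ σ.Mentions p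
  | _, .time α => p _ (.time α) ∨ α.Mentions p
  | _, .start σ => p _ (.start σ) ∨ σ.Mentions p
  | _, .S0 => p _ .S0
  | _, .doAct α σ => p _ (.doAct α σ) ∨ α.Mentions p ∨ σ.Mentions p

/-- Some term that occurs in the atom has the property `p`. -/
def Atom.Mentions {Γ : List Srt} (p : ∀ s, Term L Γ s → Prop) : Atom L Γ → Prop
  | .eq t u => t.Mentions p ∨ u.Mentions p
  | .pred _ ts => ∃ s v, (ts s v).Mentions p
  | .rrel _ ts => ∃ i, (ts i).Mentions p
  | .rel _ ts σ => (∃ s v, (ts s v).Mentions p) ∨ σ.Mentions p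
  | .poss α σ => α.Mentions p ∨ σ.Mentions p
  | .prec σ σ' => σ.Mentions p ∨ σ'.Mentions p

/-- `x` is a temporal fluent term with fluent symbol `f`. -/
def IsTemp (f : L.TempFl) {Γ : List Srt} (s : Srt) (x : Term L Γ s) : Prop :=
  ∃ ts τ σ, (Term.temp f ts τ σ).Same x

/-- The temporal fluent `f` occurs in the formula. -/
def Fml.MentionsTemp (f : L.TempFl) : ∀ {Γ : List Srt}, Fml L Γ → Prop
  | _, .atom a => a.Mentions (IsTemp f)
  | _, .neg φ => φ.MentionsTemp f
  | _, .and φ ψ => φ.MentionsTemp f ∨ ψ.MentionsTemp f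
  | _, .ex _ φ => φ.MentionsTemp f

/-- `x` is a situation term other than `σ`. -/
def OtherSit {Γ : List Srt} (σ : Term L Γ .sit) (s : Srt) (x : Term L Γ s) : Prop :=
  s = .sit ∧ ¬ σ.Same x

/-- Uniformity of a term in `σ`, where `σ` is a situation variable or `S0`: no situation term other
than `σ` occurs. -/
def Term.Uniform {Γ : List Srt} {s : Srt} (t : Term L Γ s) (σ : Term L Γ .sit) : Prop :=
  ¬ t.Mentions (OtherSit σ)

/-- Uniformity of an atom in `σ`, where `σ` is a situation variable or `S0`: no situation term other
than `σ`, no `Poss`, no `⊏` and no equality between situations. -/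
def Atom.Uniform {Γ : List Srt} (a : Atom L Γ) (σ : Term L Γ .sit) : Prop :=
  ¬ a.Mentions (OtherSit σ) ∧
    match a with
    | .eq (s := s) _ _ => s ≠ .sit
    | .poss _ _ => False
    | .prec _ _ => False
    | _ => True

/-- Uniformity of a formula in `σ`, where `σ` is a situation variable or `S0`: moreover there is no
quantifier over situations. -/
def Fml.Uniform : ∀ {Γ : List Srt}, Fml L Γ → Term L Γ .sit → Prop
  | _, .atom a, σ => a.Uniform σ
  | _, .neg φ, σ => φ.Uniform σ
  | _, .and φ ψ, σ => φ.Uniform σ ∧ ψ.Uniform σ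
  | _, .ex s φ, σ => s ≠ .sit ∧ φ.Uniform σ.wk

/-- `x` is a situation variable. -/
def IsSitVar {Γ : List Srt} (s : Srt) (x : Term L Γ s) : Prop :=
  s = .sit ∧ ∃ v, x = .var v

/-- Regressable atoms.  All situation terms have the form `do([α₁, …, αₙ], S0)`, that is, there is
no situation variable; in `Poss (α, σ)` the term `α` is an action function applied to arguments;
there is no `⊏` and no equality between situations. -/
def Atom.Regressable {Γ : List Srt} (a : Atom L Γ) : Prop :=
  ¬ a.Mentions IsSitVar ∧
    match a with
    | .eq (s := s) _ _ => s ≠ .sit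
    | .poss α _ => ∃ A ts τ, α = .action A ts τ
    | .prec _ _ => False
    | _ => True

/-- Regressable formulas: the atoms are regressable and there is no quantifier over situations. -/
def Fml.Regressable : ∀ {Γ : List Srt}, Fml L Γ → Prop
  | _, .atom a => a.Regressable
  | _, .neg φ => φ.Regressable
  | _, .and φ ψ => φ.Regressable ∧ ψ.Regressable
  | _, .ex s φ => s ≠ .sit ∧ φ.Regressable

/-- Situation terms `do([α₁, …, αₙ], S0)` whose action arguments are uniform in `S0`. -/
def Term.PrimeSit {Γ : List Srt} : ∀ {s}, Term L Γ s → Prop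
  | _, .S0 => True
  | _, .doAct α σ => α.Uniform .S0 ∧ σ.PrimeSit
  | _, _ => False

/-- The atom is not a `Poss` atom. -/
def Atom.NotPoss {Γ : List Srt} : Atom L Γ → Prop
  | .poss _ _ => False
  | _ => True

/-! ### Semantics -/

/-- The domain of each sort; the sort `real` always denotes the real numbers. -/
abbrev Carrier (O A S : Type) : Srt → Type
  | .obj => O
  | .act => A
  | .real => ℝ
  | .sit => S

/-- Structures for the language.  The symbols in `L.RFn` and `L.RRel` have their fixed meaning. -/
structure Struct (L : Signature) where
  Obj : Type
  Action : Type
  Sit : Type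
  [nonempty_obj : Nonempty Obj]
  [nonempty_action : Nonempty Action]
  fn : ∀ {s} (f : L.Fn s), Asg (Carrier Obj Action Sit) (L.fnArgs f) → Carrier Obj Action Sit s
  pred : ∀ P : L.Pred, Asg (Carrier Obj Action Sit) (L.predArgs P) → Prop
  action : ∀ A : L.Act, Asg (Carrier Obj Action Sit) (L.actArgs A) → ℝ → Action
  rel : ∀ F : L.RelFl, Asg (Carrier Obj Action Sit) (L.relArgs F) → Sit → Prop
  fl : ∀ {s} (f : FunFl L s),
    Asg (Carrier Obj Action Sit) f.args → Sit → Carrier Obj Action Sit s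
  temp : ∀ f : L.TempFl, Asg (Carrier Obj Action Sit) (L.tempArgs f) → ℝ → Sit → ℝ
  time : Action → ℝ
  start : Sit → ℝ
  S0 : Sit
  doAct : Action → Sit → Sit
  poss : Action → Sit → Prop
  prec : Sit → Sit → Prop

/-- The domain of a structure at a sort. -/
abbrev Struct.Dom (M : Struct L) : Srt → Type := Carrier M.Obj M.Action M.Sit

/-- The value of a term in an environment. -/
def Term.eval (M : Struct L) {Γ : List Srt} (ρ : Asg M.Dom Γ) : ∀ {s}, Term L Γ s → M.Dom s
  | _, .var v => ρ _ v
  | _, .fn f ts => M.fn f fun s v => (ts s v).eval M ρ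
  | _, .rfn f ts => L.rfnVal f fun i => (ts i).eval M ρ
  | _, .action A ts τ => M.action A (fun s v => (ts s v).eval M ρ) (τ.eval M ρ)
  | _, .fl f ts σ => M.fl f (fun s v => (ts s v).eval M ρ) (σ.eval M ρ)
  | _, .temp f ts τ σ => M.temp f (fun s v => (ts s v).eval M ρ) (τ.eval M ρ) (σ.eval M ρ)
  | _, .time α => M.time (α.eval M ρ)
  | _, .start σ => M.start (σ.eval M ρ)
  | _, .S0 => M.S0
  | _, .doAct α σ => M.doAct (α.eval M ρ) (σ.eval M ρ)

/-- Truth of an atom in an environment. -/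
def Atom.Holds (M : Struct L) {Γ : List Srt} (ρ : Asg M.Dom Γ) : Atom L Γ → Prop
  | .eq t u => t.eval M ρ = u.eval M ρ
  | .pred P ts => M.pred P fun s v => (ts s v).eval M ρ
  | .rrel R ts => L.rrelVal R fun i => (ts i).eval M ρ
  | .rel F ts σ => M.rel F (fun s v => (ts s v).eval M ρ) (σ.eval M ρ)
  | .poss α σ => M.poss (α.eval M ρ) (σ.eval M ρ)
  | .prec σ σ' => M.prec (σ.eval M ρ) (σ'.eval M ρ)

/-- Truth of a formula in an environment. -/
def Fml.Holds (M : Struct L) : ∀ {Γ : List Srt}, Asg M.Dom Γ → Fml L Γ → Prop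
  | _, ρ, .atom a => a.Holds M ρ
  | _, ρ, .neg φ => ¬ φ.Holds M ρ
  | _, ρ, .and φ ψ => φ.Holds M ρ ∧ ψ.Holds M ρ
  | _, ρ, .ex s φ => ∃ x : M.Dom s, φ.Holds M (Asg.cons x ρ)

/-- Truth of a sentence in a structure. -/
def Struct.Sat (M : Struct L) (φ : Sentence L) : Prop := φ.Holds M Asg.nil

/-- The foundational axioms, with full second-order induction on situations. -/
structure Struct.Foundational (M : Struct L) : Prop where
  do_inj : ∀ a a' s s', M.doAct a s = M.doAct a' s' → a = a' ∧ s = s'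
  induction : ∀ P : M.Sit → Prop, P M.S0 → (∀ a s, P s → P (M.doAct a s)) → ∀ s, P s
  prec_S0 : ∀ s, ¬ M.prec s M.S0
  prec_do : ∀ a s s', M.prec s (M.doAct a s') ↔ M.prec s s' ∨ s = s'
  start_do : ∀ a s, M.start (M.doAct a s) = M.time a

/-- The unique name axioms for actions. -/
structure Struct.UniqueNames (M : Struct L) : Prop where
  names_ne : ∀ A B, A ≠ B → ∀ x t y t', M.action A x t ≠ M.action B y t'
  args_eq : ∀ A x t y t', M.action A x t = M.action A y t' → x = y ∧ t = t'

/-- Models of the unique name axioms and of the sentences in `T`. -/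
def Struct.UnaModel (M : Struct L) (T : Set (Sentence L)) : Prop :=
  M.UniqueNames ∧ ∀ φ ∈ T, M.Sat φ

/-- Universal closure of a formula. -/
def Fml.closure : ∀ {Γ : List Srt}, Fml L Γ → Sentence L
  | [], φ => φ
  | s :: _, φ => Fml.closure (.neg (.ex s (.neg φ)))

/-- The axiom `time (A (x̄, t)) = t`. -/
def timeAxiom (A : L.Act) : Sentence L :=
  Fml.closure (Γ := .real :: L.actArgs A)
    (.eq (.time (.action A (fun _ v => .var v.succ) hd)) hd)

/-! ### Temporal basic action theories -/

/-- A temporal basic action theory.  It is given by the right-hand sides of its precondition,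
successor state and state evolution axioms and by its initial theory. -/
structure TemporalBAT (L : Signature) where
  /-- `Π_A (x̄, t, s)`, in the context `s, t, x̄` -/
  pre : ∀ A : L.Act, Fml L (.sit :: .real :: L.actArgs A)
  pre_uniform : ∀ A, (pre A).Uniform hd
  /-- `Φ_F (x̄, a, s)`, in the context `s, a, x̄` -/
  relSSA : ∀ F : L.RelFl, Fml L (.sit :: .act :: L.relArgs F)
  relSSA_uniform : ∀ F, (relSSA F).Uniform hd
  /-- `φ_f (x̄, y, a, s)`, in the context `s, a, y, x̄`; this includes the fluents `f_init` -/
  funSSA : ∀ {s} (f : FunFl L s), Fml L (.sit :: .act :: s :: f.args)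
  funSSA_uniform : ∀ {s} (f : FunFl L s), (funSSA f).Uniform hd
  /-- `ψ_f (x̄, t, y, s)`, in the context `s, y, t, x̄` -/
  sea : ∀ f : L.TempFl, Fml L (.sit :: .real :: .real :: L.tempArgs f)
  sea_uniform : ∀ f, (sea f).Uniform hd
  /-- the initial theory -/
  initial : Set (Sentence L)
  initial_uniform : ∀ φ ∈ initial, φ.Uniform .S0
  timeAxiom_mem : ∀ A, timeAxiom A ∈ initial
  /-- `φ_f` determines a unique value -/
  fun_consistent : ∀ {s} (f : FunFl L s) (M : Struct L), M.UnaModel initial →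
    ∀ (x : Asg M.Dom f.args) (a : M.Action) (σ : M.Sit),
      ∃! y : M.Dom s, (funSSA f).Holds M (Asg.cons σ (Asg.cons a (Asg.cons y x)))
  /-- `ψ_f` determines a unique value -/
  sea_consistent : ∀ (f : L.TempFl) (M : Struct L), M.UnaModel initial →
    ∀ (x : Asg M.Dom (L.tempArgs f)) (t : ℝ) (σ : M.Sit),
      ∃! y : ℝ, (sea f).Holds M
        (Asg.cons (s := .sit) σ (Asg.cons (s := .real) y (Asg.cons (s := .real) t x)))
  /-- at the start of a situation `ψ_f` gives the value of `f_init` -/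
  init_consistent : ∀ (f : L.TempFl) (M : Struct L), M.UnaModel initial →
    ∀ (x : Asg M.Dom (L.tempArgs f)) (σ : M.Sit),
      (sea f).Holds M (Asg.cons (s := .sit) σ (Asg.cons (s := .real) (M.fl (.init f) x σ)
        (Asg.cons (s := .real) (M.start σ) x)))
  /-- a temporal fluent that occurs in the initial theory obeys its state evolution axiom at `S0` -/
  initial_consistent : ∀ f : L.TempFl, (∃ φ ∈ initial, φ.MentionsTemp f) →
    ∀ M : Struct L, M.UnaModel initial → ∀ (x : Asg M.Dom (L.tempArgs f)) (t y : ℝ),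
      M.temp f x t M.S0 = y ↔ (sea f).Holds M
        (Asg.cons (s := .sit) M.S0 (Asg.cons (s := .real) y (Asg.cons (s := .real) t x)))

namespace TemporalBAT

variable (D : TemporalBAT L)

/-- `f ≻ f'`: the temporal fluent `f'` occurs on the right-hand side of the state evolution axiom
for `f`. -/
def Above (f f' : L.TempFl) : Prop := (D.sea f).MentionsTemp f'

/-- There is no cycle `f₁ ≻ f₂ ≻ ⋯ ≻ fₙ ≻ f₁`. -/
def Stratified : Prop := ∀ f, ¬ Relation.TransGen D.Above f f

/-- Models of the whole theory. -/
structure Model (M : Struct L) : Prop where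
  foundational : M.Foundational
  initial : M.UnaModel D.initial
  pre : ∀ (A : L.Act) (x : Asg M.Dom (L.actArgs A)) (t : ℝ) (σ : M.Sit),
    M.poss (M.action A x t) σ ↔
      (D.pre A).Holds M (Asg.cons (s := .sit) σ (Asg.cons (s := .real) t x))
  relSSA : ∀ (F : L.RelFl) (x : Asg M.Dom (L.relArgs F)) (a : M.Action) (σ : M.Sit),
    M.rel F x (M.doAct a σ) ↔
      (D.relSSA F).Holds M (Asg.cons (s := .sit) σ (Asg.cons (s := .act) a x))
  funSSA : ∀ {s} (f : FunFl L s) (x : Asg M.Dom f.args) (y : M.Dom s) (a : M.Action) (σ : M.Sit),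
    M.fl f x (M.doAct a σ) = y ↔
      (D.funSSA f).Holds M (Asg.cons σ (Asg.cons a (Asg.cons y x)))
  sea : ∀ (f : L.TempFl) (x : Asg M.Dom (L.tempArgs f)) (t y : ℝ) (σ : M.Sit),
    M.temp f x t σ = y ↔ (D.sea f).Holds M
      (Asg.cons (s := .sit) σ (Asg.cons (s := .real) y (Asg.cons (s := .real) t x)))

/-- The whole theory entails the sentence. -/
def Entails (φ : Sentence L) : Prop := ∀ M : Struct L, D.Model M → M.Sat φ

/-- The initial theory and the unique name axioms entail the sentence. -/
def InitialEntails (φ : Sentence L) : Prop := ∀ M : Struct L, M.UnaModel D.initial → M.Sat φ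

/-! ### Regression -/

/-- `D.Regr W V`: the formula `V` is a result `R[W]` of regression.  The operator leaves open in
which order the subterms of an atom are treated, so it is a relation. -/
inductive Regr : ∀ {Γ : List Srt}, Fml L Γ → Fml L Γ → Prop
  /-- an atom about `S0` without temporal fluents is left unchanged -/
  | base {Γ : List Srt} (a : Atom L Γ) (hu : a.Uniform .S0)
      (ht : ∀ f : L.TempFl, ¬ a.Mentions (IsTemp f)) : Regr (.atom a) (.atom a)
  /-- `Poss (A (t̄, τ), σ)` becomes `Π_A (t̄, τ, σ)` -/
  | poss {Γ : List Srt} (A : L.Act) (ts : Asg (Term L Γ) (L.actArgs A)) (τ : Term L Γ .real)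
      (σ : Term L Γ .sit) (V : Fml L Γ)
      (h : Regr ((D.pre A).subst (Asg.cons σ (Asg.cons τ ts))) V) :
      Regr (.atom (.poss (.action A ts τ) σ)) V
  /-- `F (t̄, do (α, σ))` becomes `Φ_F (t̄, α, σ)` -/
  | rel {Γ : List Srt} (F : L.RelFl) (ts : Asg (Term L Γ) (L.relArgs F)) (α : Term L Γ .act)
      (σ : Term L Γ .sit) (V : Fml L Γ)
      (h : Regr ((D.relSSA F).subst (Asg.cons σ (Asg.cons α ts))) V) :
      Regr (.atom (.rel F ts (.doAct α σ))) V
  /-- for a prime term `f (t̄, do (α, σ))` in `W`, the atom `W` becomes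
  `∃ y, φ_f (t̄, y, α, σ) ∧ W'`, where `W'` has `y` in place of the term -/
  | func {Γ : List Srt} (W : Atom L Γ) (hW : W.NotPoss) {s : Srt} (f : FunFl L s)
      (ts : Asg (Term L Γ) f.args) (α : Term L Γ .act) (σ : Term L Γ .sit)
      (hm : W.Mentions fun _ x => (Term.fl f ts (.doAct α σ)).Same x)
      (hts : ∀ s v, (ts s v).Uniform .S0) (hσ : (Term.doAct α σ).PrimeSit) (V : Fml L Γ)
      (h : Regr (.ex s (.and
        ((D.funSSA f).subst
          (Asg.cons σ.wk (Asg.cons α.wk (Asg.cons hd fun s v => (ts s v).wk))))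
        (.atom (W.wk.repl (Term.fl f ts (.doAct α σ)).wk hd)))) V) :
      Regr (.atom W) V
  /-- for a term `f (t̄, τ, σ)` with a temporal fluent `f` in `W`, the atom `W` becomes
  `∃ y, (τ = start σ ∧ y = f_init (t̄, σ) ∨ τ ≠ start σ ∧ ψ_f (t̄, τ, y, σ)) ∧ W'`,
  where `W'` has `y` in place of the term -/
  | temp {Γ : List Srt} (W : Atom L Γ) (hW : W.NotPoss) (f : L.TempFl)
      (ts : Asg (Term L Γ) (L.tempArgs f)) (τ : Term L Γ .real) (σ : Term L Γ .sit)
      (hm : W.Mentions fun _ x => (Term.temp f ts τ σ).Same x) (V : Fml L Γ)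
      (h : Regr (.ex .real (.and
        (.or
          (.and (.eq τ.wk (.start σ.wk))
            (.eq hd (.fl (.init f) (fun s v => (ts s v).wk) σ.wk)))
          (.and (.neg (.eq τ.wk (.start σ.wk)))
            ((D.sea f).subst
              (Asg.cons σ.wk (Asg.cons hd (Asg.cons τ.wk fun s v => (ts s v).wk))))))
        (.atom (W.wk.repl (Term.temp f ts τ σ).wk hd)))) V) :
      Regr (.atom W) V
  /-- `start (do (α, σ))` is replaced by `time α` -/
  | start {Γ : List Srt} (W : Atom L Γ) (hW : W.NotPoss) (α : Term L Γ .act) (σ : Term L Γ .sit)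
      (hm : W.Mentions fun _ x => (Term.start (.doAct α σ)).Same x) (V : Fml L Γ)
      (h : Regr (.atom (W.repl (.start (.doAct α σ)) (.time α))) V) :
      Regr (.atom W) V
  | neg {Γ : List Srt} (φ V : Fml L Γ) (h : Regr φ V) : Regr (.neg φ) (.neg V)
  | and {Γ : List Srt} (φ ψ V V' : Fml L Γ) (h : Regr φ V) (h' : Regr ψ V') :
      Regr (.and φ ψ) (.and V V')
  | ex {Γ : List Srt} (s : Srt) (φ V : Fml L (s :: Γ)) (h : Regr φ V) : Regr (.ex s φ) (.ex s V)

end TemporalBAT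

end SitCalc

/-! There are three independent points: the rules preserve truth, the initial theory has enough
models, and some strategy terminates.

Truth and shape. In a model of the whole theory each rule replaces an atom by an equivalent formula:
the condition on the new variable `y` holds exactly for the value of the term that `y` replaces. For
temporal fluents at the start of a situation this is the required consistency of ψ_f with `f_init`.
Hence `Regr.sound`, by induction on the derivation. Since right-hand sides are uniform,
regressability is preserved, so every result is uniform in `S0` and free of temporal fluents
(`Regr.uniform`).

Conservativity. Soundness settles the direction from the initial theory to the whole theory. For the
converse, a model `M` of the initial theory and of unique names is unrolled: situations become
finite sequences of actions, the fluents at the empty sequence come from `M`, and later states are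
computed by recursion from the axioms. Temporal fluents are defined by well-founded recursion along
`Above`, except that those occurring in the initial theory keep their values at `S0`. A uniform
formula depends only on the state at its situation (`Sim.holds`), so the axioms hold by construction
(`model_unroll`), and a sentence uniform in `S0` without temporal fluents has the same truth value
in `M` and in the unrolled structure (`sat_unroll`).

Existence. Each fluent or `start` term gets a weight that is governed first by the length of its
situation and then, for temporal fluents, by the rank in the stratification. The strategy always
treats an innermost term of positive weight. Its arguments are then uniform in `S0`, so the side
conditions of rule 4 hold, and the condition on `y` contains only smaller weights. The rest of the
atom keeps its bound on the weights but loses all occurrences of the term. Thus `exists_regr_atom`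
is a lexicographic induction on the greatest admitted weight and the sum of all weights of subterms.
`Poss` atoms are rewritten once, beforehand, as right-hand sides contain no `Poss`. -/

namespace SitCalc

/-! ### Substitution, replacement, and soundness of the rules in models. -/

section Semantics

variable {L : Signature}

theorem Var.mem {Γ : List Srt} {s : Srt} (v : Var Γ s) : s ∈ Γ := by
  induction v with
  | zero => exact List.mem_cons_self
  | succ v ih => exact List.mem_cons_of_mem _ ih

theorem FunFl.sort_ne_sit {s : Srt} (f : FunFl L s) : s ≠ .sit := by
  cases f with
  | ord f => exact L.ord_sort f
  | init f => exact fun h => nomatch h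

theorem FunFl.args_noSit {s : Srt} (f : FunFl L s) : Srt.sit ∉ f.args := by
  cases f with
  | ord f => exact L.ord_noSit f
  | init f => exact L.temp_noSit f

theorem Signature.fn_ne_sit {s : Srt} (f : L.Fn s) : s ≠ .sit := by
  rcases L.fn_sort f with rfl | rfl <;> exact fun h => nomatch h

/-- Right-hand sides of axioms are instantiated by nested `Asg.cons`; this turns their evaluation
into the environments in which the axioms of a model are stated. -/
theorem Asg.map_cons {X Y : Srt → Type} (e : ∀ s, X s → Y s) {Γ : List Srt} {s : Srt} (x : X s)
    (ρ : Asg X Γ) :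
    (fun s' v => e s' (Asg.cons x ρ s' v) : Asg Y (s :: Γ)) =
      Asg.cons (e s x) (fun s' v => e s' (ρ s' v)) := by
  funext s' v
  cases v <;> rfl

theorem Asg.ext_nil {X : Srt → Type} (ρ : Asg X []) : ρ = Asg.nil := by
  funext s v
  cases v

theorem Term.eval_subst (M : Struct L) {Γ Δ : List Srt} (ρ : Asg M.Dom Δ)
    (θ : Asg (Term L Δ) Γ) {s : Srt} (t : Term L Γ s) :
    (t.subst θ).eval M ρ = t.eval M (fun s v => (θ s v).eval M ρ) := by
  induction t <;> simp_all [Term.subst, Term.eval]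

theorem Term.eval_wk (M : Struct L) {Γ : List Srt} (ρ : Asg M.Dom Γ) {s s' : Srt} (x : M.Dom s')
    (t : Term L Γ s) : (t.wk (s' := s')).eval M (Asg.cons x ρ) = t.eval M ρ :=
  Term.eval_subst M _ _ t

theorem Atom.holds_subst (M : Struct L) {Γ Δ : List Srt} (ρ : Asg M.Dom Δ)
    (θ : Asg (Term L Δ) Γ) (a : Atom L Γ) :
    (a.subst θ).Holds M ρ ↔ a.Holds M (fun s v => (θ s v).eval M ρ) := by
  cases a <;> simp [Atom.subst, Atom.Holds, Term.eval_subst]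

theorem Atom.holds_wk (M : Struct L) {Γ : List Srt} (ρ : Asg M.Dom Γ) {s' : Srt} (x : M.Dom s')
    (a : Atom L Γ) : (a.wk (s' := s')).Holds M (Asg.cons x ρ) ↔ a.Holds M ρ :=
  Atom.holds_subst M _ _ a

theorem Fml.holds_subst (M : Struct L) {Γ Δ : List Srt} (ρ : Asg M.Dom Δ)
    (θ : Asg (Term L Δ) Γ) (φ : Fml L Γ) :
    (φ.subst θ).Holds M ρ ↔ φ.Holds M (fun s v => (θ s v).eval M ρ) := by
  induction φ generalizing Δ with
  | atom a => exact Atom.holds_subst M ρ θ a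
  | neg φ ih => exact not_congr (ih ρ θ)
  | and φ ψ ih ih' => exact and_congr (ih ρ θ) (ih' ρ θ)
  | ex s φ ih =>
    refine exists_congr fun x => (ih _ _).trans ?_
    rw [Asg.map_cons (X := Term L _) (fun s t => t.eval M (Asg.cons x ρ))]
    simp only [Term.eval_wk]
    rfl

theorem Fml.holds_or (M : Struct L) {Γ : List Srt} (ρ : Asg M.Dom Γ) (φ ψ : Fml L Γ) :
    (φ.or ψ).Holds M ρ ↔ φ.Holds M ρ ∨ ψ.Holds M ρ := by
  simp only [Fml.or, Fml.Holds]
  tauto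

theorem Term.same_refl {Γ : List Srt} {s : Srt} (t : Term L Γ s) : t.Same t := ⟨rfl, rfl⟩

theorem Term.eval_ifSame (M : Struct L) {Γ : List Srt} (ρ : Asg M.Dom Γ) {s s' : Srt}
    (t u : Term L Γ s) (h : t.eval M ρ = u.eval M ρ) (x y : Term L Γ s')
    (hy : y.eval M ρ = x.eval M ρ) : (Term.ifSame t u x y).eval M ρ = x.eval M ρ := by
  unfold Term.ifSame
  split
  · next e =>
    obtain ⟨rfl, rfl⟩ := e
    exact h.symm
  · exact hy

theorem Term.eval_repl (M : Struct L) {Γ : List Srt} (ρ : Asg M.Dom Γ) {s s' : Srt}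
    (t u : Term L Γ s) (h : t.eval M ρ = u.eval M ρ) (x : Term L Γ s') :
    (Term.repl t u x).eval M ρ = x.eval M ρ := by
  induction x <;> rw [Term.repl] <;> apply Term.eval_ifSame M ρ t u h <;>
    simp_all [Term.eval]

theorem Atom.holds_repl (M : Struct L) {Γ : List Srt} (ρ : Asg M.Dom Γ) {s : Srt}
    (t u : Term L Γ s) (h : t.eval M ρ = u.eval M ρ) (a : Atom L Γ) :
    (a.repl t u).Holds M ρ ↔ a.Holds M ρ := by
  cases a <;> simp [Atom.repl, Atom.Holds, Term.eval_repl M ρ t u h]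

namespace TemporalBAT

variable (D : TemporalBAT L)

/-- Justifies the first disjunct of rule 5: `init_consistent` makes `f_init` a solution of ψ_f at
the start, and the state evolution axiom turns a solution into the value. -/
theorem Model.temp_start {D : TemporalBAT L} {M : Struct L} (hM : D.Model M) (f : L.TempFl)
    (x : Asg M.Dom (L.tempArgs f)) (σ : M.Sit) :
    M.temp f x (M.start σ) σ = M.fl (.init f) x σ :=
  (hM.sea f x _ _ σ).2 (D.init_consistent f M hM.initial x σ)

/-- In a model of the theory a regressed formula is equivalent to the original one. -/
theorem Regr.sound {D : TemporalBAT L} {M : Struct L} (hM : D.Model M) {Γ : List Srt}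
    {W V : Fml L Γ} (h : D.Regr W V) (ρ : Asg M.Dom Γ) : W.Holds M ρ ↔ V.Holds M ρ := by
  induction h with
  | base => exact Iff.rfl
  | poss A ts τ σ V h ih =>
    rw [← ih ρ, Fml.holds_subst, Asg.map_cons (X := Term L _) fun s t => t.eval M ρ,
      Asg.map_cons (X := Term L _) fun s t => t.eval M ρ]
    exact hM.pre A _ _ _
  | rel F ts α σ V h ih =>
    rw [← ih ρ, Fml.holds_subst, Asg.map_cons (X := Term L _) fun s t => t.eval M ρ,
      Asg.map_cons (X := Term L _) fun s t => t.eval M ρ]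
    exact hM.relSSA F _ _ _
  | func W hW f ts α σ hm hts hσ V h ih =>
    rw [← ih ρ]
    -- The condition on `y` says that `y` is the value of the replaced term. So the quantifier has
    -- exactly one candidate, and for it the replacement does not affect truth.
    have key : ∀ y, M.fl f (fun s v => (ts s v).eval M ρ) (M.doAct (α.eval M ρ) (σ.eval M ρ)) = y ↔
        ((D.funSSA f).subst (Asg.cons σ.wk (Asg.cons α.wk (Asg.cons hd fun s v =>
          (ts s v).wk)))).Holds M (Asg.cons y ρ) := fun y => by
      rw [Fml.holds_subst, Asg.map_cons (X := Term L _) fun s t => t.eval M (Asg.cons y ρ),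
        Asg.map_cons (X := Term L _) fun s t => t.eval M (Asg.cons y ρ),
        Asg.map_cons (X := Term L _) fun s t => t.eval M (Asg.cons y ρ)]
      simp only [Term.eval_wk]
      exact hM.funSSA f _ _ _ _
    have hrepl : ∀ y, M.fl f (fun s v => (ts s v).eval M ρ)
        (M.doAct (α.eval M ρ) (σ.eval M ρ)) = y →
        ((W.wk.repl (Term.fl f ts (.doAct α σ)).wk hd).Holds M (Asg.cons y ρ) ↔ W.Holds M ρ) :=
      fun y hy => by
      rw [Atom.holds_repl, Atom.holds_wk]
      rw [Term.eval_wk]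
      exact hy
    constructor
    · intro hw
      exact ⟨_, (key _).1 rfl, (hrepl _ rfl).2 hw⟩
    · rintro ⟨y, h1, h2⟩
      exact (hrepl y ((key y).2 h1)).1 h2
  | temp W hW f ts τ σ hm V h ih =>
    rw [← ih ρ]
    have key : ∀ y : ℝ, M.temp f (fun s v => (ts s v).eval M ρ) (τ.eval M ρ) (σ.eval M ρ) = y ↔
        Fml.Holds M (Asg.cons (s := .real) y ρ) (.or
          (.and (.eq τ.wk (.start σ.wk))
            (.eq hd (.fl (.init f) (fun s v => (ts s v).wk) σ.wk)))
          (.and (.neg (.eq τ.wk (.start σ.wk)))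
            ((D.sea f).subst
              (Asg.cons σ.wk (Asg.cons hd (Asg.cons τ.wk fun s v => (ts s v).wk)))))) := fun y => by
      rw [Fml.holds_or]
      simp only [Fml.Holds]
      rw [Fml.holds_subst, Asg.map_cons (X := Term L _)
        fun s t => t.eval M (Asg.cons (X := M.Dom) (s := .real) y ρ),
        Asg.map_cons (X := Term L _)
        fun s t => t.eval M (Asg.cons (X := M.Dom) (s := .real) y ρ),
        Asg.map_cons (X := Term L _)
        fun s t => t.eval M (Asg.cons (X := M.Dom) (s := .real) y ρ)]
      simp only [Fml.eq, Fml.Holds, Atom.Holds, Term.eval, Term.eval_wk]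
      have hy : (hd : Term L (.real :: _) .real).eval M
          (Asg.cons (X := M.Dom) (s := .real) y ρ) = y := rfl
      rw [hy]
      -- At the start the first disjunct gives the value, by `temp_start`; at other times the second
      -- one is the state evolution axiom.
      by_cases hs : τ.eval M ρ = M.start (σ.eval M ρ)
      · rw [hs, hM.temp_start]
        simp only [true_and, not_true_eq_false, false_and, or_false]
        exact eq_comm
      · simp only [hs, false_and, false_or, not_false_eq_true, true_and]
        exact hM.sea f _ _ _ _
    have hrepl : ∀ y : ℝ, M.temp f (fun s v => (ts s v).eval M ρ) (τ.eval M ρ) (σ.eval M ρ) = y →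
        ((W.wk.repl (Term.temp f ts τ σ).wk hd).Holds M (Asg.cons (s := .real) y ρ) ↔
          W.Holds M ρ) :=
      fun y hy => by
      rw [Atom.holds_repl, Atom.holds_wk]
      rw [Term.eval_wk]
      exact hy
    constructor
    · intro hw
      exact ⟨_, (key _).1 rfl, (hrepl _ rfl).2 hw⟩
    · rintro ⟨y, h1, h2⟩
      exact (hrepl y ((key y).2 h1)).1 h2
  | start W hW α σ hm V h ih =>
    rw [← ih ρ]
    -- The only foundational axiom on which soundness relies is `start_do`.
    exact (Atom.holds_repl M ρ (.start (.doAct α σ)) (.time α) (hM.foundational.start_do _ _) W).symm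
  | neg φ V h ih => exact not_congr (ih ρ)
  | and φ ψ V V' h h' ih ih' => exact and_congr (ih ρ) (ih' ρ)
  | ex s φ V h ih => exact exists_congr fun x => ih _

end TemporalBAT

end Semantics

/-! ### Regressability is preserved by the rules. -/

section Regressability

variable {L : Signature}

theorem Term.mentions_self {Γ : List Srt} {p : ∀ s, Term L Γ s → Prop} {s : Srt} {t : Term L Γ s}
    (h : p s t) : t.Mentions p := by
  cases t <;> simp [Term.Mentions, h]

theorem Term.Mentions.mono {Γ : List Srt} {p q : ∀ s, Term L Γ s → Prop}
    (hpq : ∀ s x, p s x → q s x) {s : Srt} {t : Term L Γ s} (h : t.Mentions p) : t.Mentions q := by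
  induction t <;> simp only [Term.Mentions] at h ⊢ <;> grind

/-- Transfers what is known about an atom, such as the absence of situation variables or a bound on
weights, to the term singled out by a rule. -/
theorem Term.Mentions.trans {Γ : List Srt} {p : ∀ s, Term L Γ s → Prop} {s s' : Srt}
    {t : Term L Γ s} {x : Term L Γ s'} (h : x.Mentions fun _ z => t.Same z)
    (ht : t.Mentions p) : x.Mentions p := by
  induction x with
  | var | S0 =>
    obtain ⟨rfl, rfl⟩ := h
    exact ht
  | fn f ts ih =>
    rcases h with ⟨rfl, rfl⟩ | ⟨s, v, h⟩
    · exact ht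
    · exact .inr ⟨s, v, ih s v h⟩
  | rfn f ts ih =>
    rcases h with ⟨rfl, rfl⟩ | ⟨i, h⟩
    · exact ht
    · exact .inr ⟨i, ih i h⟩
  | action A ts τ ih ih' | fl f ts τ ih ih' =>
    rcases h with ⟨rfl, rfl⟩ | ⟨s, v, h⟩ | h
    · exact ht
    · exact .inr (.inl ⟨s, v, ih s v h⟩)
    · exact .inr (.inr (ih' h))
  | temp f ts τ σ ih ih' ih'' =>
    rcases h with ⟨rfl, rfl⟩ | ⟨s, v, h⟩ | h | h
    · exact ht
    · exact .inr (.inl ⟨s, v, ih s v h⟩)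
    · exact .inr (.inr (.inl (ih' h)))
    · exact .inr (.inr (.inr (ih'' h)))
  | time α ih | start σ ih =>
    rcases h with ⟨rfl, rfl⟩ | h
    · exact ht
    · exact .inr (ih h)
  | doAct α σ ih ih' =>
    rcases h with ⟨rfl, rfl⟩ | h | h
    · exact ht
    · exact .inr (.inl (ih h))
    · exact .inr (.inr (ih' h))

theorem Atom.Mentions.trans {Γ : List Srt} {p : ∀ s, Term L Γ s → Prop} {s : Srt}
    {t : Term L Γ s} {a : Atom L Γ} (h : a.Mentions fun _ z => t.Same z)
    (ht : t.Mentions p) : a.Mentions p := by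
  cases a with
  | eq x y => exact h.imp (·.trans ht) (·.trans ht)
  | pred P ts =>
    obtain ⟨s, v, h⟩ := h
    exact ⟨s, v, h.trans ht⟩
  | rrel R ts =>
    obtain ⟨i, h⟩ := h
    exact ⟨i, h.trans ht⟩
  | rel F ts σ =>
    rcases h with ⟨s, v, h⟩ | h
    · exact .inl ⟨s, v, h.trans ht⟩
    · exact .inr (h.trans ht)
  | poss α σ => exact h.imp (·.trans ht) (·.trans ht)
  | prec σ σ' => exact h.imp (·.trans ht) (·.trans ht)

theorem Term.mentions_wk {Γ : List Srt} {s' : Srt} (p : ∀ s, Term L (s' :: Γ) s → Prop) {s : Srt}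
    (t : Term L Γ s) : (t.wk (s' := s')).Mentions p ↔ t.Mentions fun s x => p s x.wk := by
  unfold Term.wk
  induction t <;> simp_all [Term.subst, Term.Mentions, shift]

theorem Atom.mentions_wk {Γ : List Srt} {s' : Srt} (p : ∀ s, Term L (s' :: Γ) s → Prop)
    (a : Atom L Γ) : (a.wk (s' := s')).Mentions p ↔ a.Mentions fun s x => p s x.wk := by
  have h := fun {s} (t : Term L Γ s) => Term.mentions_wk p t
  unfold Term.wk at h
  cases a <;> simp [Atom.wk, Atom.subst, Atom.Mentions, h] <;> rfl

theorem isSitVar_wk {Γ : List Srt} {s s' : Srt} (t : Term L Γ s) :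
    IsSitVar s (t.wk (s' := s')) ↔ IsSitVar s t := by
  refine and_congr_right fun _ => ?_
  cases t <;> simp [Term.wk, Term.subst, shift]

theorem Term.mentions_isSitVar_wk {Γ : List Srt} {s s' : Srt} (t : Term L Γ s) :
    (t.wk (s' := s')).Mentions IsSitVar ↔ t.Mentions IsSitVar := by
  rw [Term.mentions_wk]
  simp only [isSitVar_wk]

theorem Term.not_isSitVar_hd {Γ : List Srt} {s : Srt} (hs : s ≠ .sit) :
    ¬ (hd : Term L (s :: Γ) s).Mentions IsSitVar := fun h => hs h.1

theorem Term.mentions_isSitVar_subst {Γ Δ : List Srt} {θ : Asg (Term L Δ) Γ}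
    (hθ : ∀ s v, ¬ (θ s v).Mentions IsSitVar) {s : Srt} (t : Term L Γ s) :
    ¬ (t.subst θ).Mentions IsSitVar := by
  induction t <;> simp_all [Term.subst, Term.Mentions, IsSitVar]

theorem Asg.cons_forall {X : Srt → Type} {p : ∀ s, X s → Prop} {Γ : List Srt} {s : Srt} {x : X s}
    {ρ : Asg X Γ} (hx : p s x) (hρ : ∀ s v, p s (ρ s v)) (s' : Srt) (v : Var (s :: Γ) s') :
    p s' (Asg.cons x ρ s' v) := by
  cases v with
  | zero => exact hx
  | succ v => exact hρ _ v

theorem Atom.regressable_subst {Γ Δ : List Srt} {θ : Asg (Term L Δ) Γ}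
    (hθ : ∀ s v, ¬ (θ s v).Mentions IsSitVar) {a : Atom L Γ} {σ : Term L Γ .sit}
    (ha : a.Uniform σ) : (a.subst θ).Regressable := by
  have h := fun {s} (t : Term L Γ s) => Term.mentions_isSitVar_subst hθ t
  cases a <;> simp_all [Atom.Uniform, Atom.Regressable, Atom.subst, Atom.Mentions]

theorem lift_noSitVar {Γ Δ : List Srt} {θ : Asg (Term L Δ) Γ}
    (hθ : ∀ s v, ¬ (θ s v).Mentions IsSitVar) {s : Srt} (hs : s ≠ .sit) :
    ∀ s' v, ¬ Term.Mentions IsSitVar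
      ((Asg.cons hd fun _ v => (θ _ v).wk : Asg (Term L (s :: Δ)) (s :: Γ)) s' v) :=
  Asg.cons_forall (p := fun _ t => ¬ Term.Mentions IsSitVar t) (Term.not_isSitVar_hd hs)
    fun s' v h => hθ s' v ((Term.mentions_isSitVar_wk _).1 h)

/-- Uniformity serves to exclude `Poss`, `⊏`, equality of situations and quantified situations.
Situation variables vanish because free variables receive terms without them and bound variables
have other sorts. -/
theorem Fml.regressable_subst {Γ Δ : List Srt} {θ : Asg (Term L Δ) Γ}
    (hθ : ∀ s v, ¬ (θ s v).Mentions IsSitVar) {φ : Fml L Γ} {σ : Term L Γ .sit}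
    (hφ : φ.Uniform σ) : (φ.subst θ).Regressable := by
  induction φ generalizing Δ with
  | atom a => exact Atom.regressable_subst hθ hφ
  | neg φ ih => exact ih hθ hφ
  | and φ ψ ih ih' => exact ⟨ih hθ hφ.1, ih' hθ hφ.2⟩
  | ex s φ ih => exact ⟨hφ.1, ih (lift_noSitVar hθ hφ.1) hφ.2⟩

theorem Term.mentions_ifSame {Γ : List Srt} {p : ∀ s, Term L Γ s → Prop} {s s' : Srt}
    (t u : Term L Γ s) (x y : Term L Γ s') (h : (Term.ifSame t u x y).Mentions p) :
    u.Mentions p ∨ y.Mentions p := by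
  unfold Term.ifSame at h
  split at h
  · next e =>
    obtain ⟨rfl, rfl⟩ := e
    exact .inl h
  · exact .inr h

theorem Term.mentions_isSitVar_repl {Γ : List Srt} {s s' : Srt} {t u : Term L Γ s}
    (hu : ¬ u.Mentions IsSitVar) (x : Term L Γ s') (hx : ¬ x.Mentions IsSitVar) :
    ¬ (Term.repl t u x).Mentions IsSitVar := by
  induction x <;> rw [Term.repl] <;> intro h <;>
    rcases Term.mentions_ifSame _ _ _ _ h with h | h <;>
    simp_all [Term.Mentions, IsSitVar]

/-- `NotPoss` matters: replacing an action term could destroy the form `A (t̄, τ)` required inside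
`Poss`. -/
theorem Atom.regressable_repl {Γ : List Srt} {s : Srt} {t u : Term L Γ s}
    (hu : ¬ u.Mentions IsSitVar) {a : Atom L Γ} (ha : a.Regressable) (hp : a.NotPoss) :
    (a.repl t u).Regressable := by
  have h := fun {s} (x : Term L Γ s) => Term.mentions_isSitVar_repl (t := t) hu x
  cases a <;> simp_all [Atom.Regressable, Atom.repl, Atom.Mentions, Atom.NotPoss]

theorem Atom.regressable_wk {Γ : List Srt} {s' : Srt} {a : Atom L Γ} (ha : a.Regressable)
    (hp : a.NotPoss) : (a.wk (s' := s')).Regressable := by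
  refine ⟨fun h => ha.1 ?_, ?_⟩
  · rw [Atom.mentions_wk] at h
    simpa only [isSitVar_wk] using h
  · have := ha.2
    cases a <;> simp_all [Atom.wk, Atom.subst, Atom.NotPoss]

theorem Atom.NotPoss.wk {Γ : List Srt} {s' : Srt} {a : Atom L Γ} (h : a.NotPoss) :
    (a.wk (s' := s')).NotPoss := by
  cases a <;> trivial

theorem Atom.NotPoss.repl {Γ : List Srt} {s : Srt} {t u : Term L Γ s} {a : Atom L Γ}
    (h : a.NotPoss) : (a.repl t u).NotPoss := by
  cases a <;> trivial

namespace TemporalBAT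

/-- The condition that `f (t̄, τ, σ)` has the value `y`, as rule 5 of regression expresses it. -/
def tempCond (D : TemporalBAT L) {Γ : List Srt} (f : L.TempFl)
    (ts : Asg (Term L Γ) (L.tempArgs f)) (τ : Term L Γ .real) (σ : Term L Γ .sit) :
    Fml L (.real :: Γ) :=
  .or
    (.and (.eq τ.wk (.start σ.wk))
      (.eq hd (.fl (.init f) (fun s v => (ts s v).wk) σ.wk)))
    (.and (.neg (.eq τ.wk (.start σ.wk)))
      ((D.sea f).subst
        (Asg.cons σ.wk (Asg.cons hd (Asg.cons τ.wk fun s v => (ts s v).wk)))))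

/-- The condition that `f (t̄, do (α, σ))` has the value `y`. -/
def funCond (D : TemporalBAT L) {Γ : List Srt} {s : Srt} (f : FunFl L s)
    (ts : Asg (Term L Γ) f.args) (α : Term L Γ .act) (σ : Term L Γ .sit) : Fml L (s :: Γ) :=
  (D.funSSA f).subst (Asg.cons σ.wk (Asg.cons α.wk (Asg.cons hd fun s v => (ts s v).wk)))

variable {D : TemporalBAT L}

theorem pre_subst_regressable {Γ : List Srt} {A : L.Act} {ts : Asg (Term L Γ) (L.actArgs A)}
    {τ : Term L Γ .real} {σ : Term L Γ .sit}
    (h : (Atom.poss (.action A ts τ) σ).Regressable) :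
    ((D.pre A).subst (Asg.cons σ (Asg.cons τ ts))).Regressable := by
  have h := h.1
  simp only [Atom.Mentions, Term.Mentions, not_or, not_exists] at h
  exact Fml.regressable_subst (Asg.cons_forall (p := fun s t => ¬ Term.Mentions IsSitVar t) h.2
    (Asg.cons_forall (p := fun s t => ¬ Term.Mentions IsSitVar t) h.1.2.2 h.1.2.1))
    (D.pre_uniform A)

theorem relSSA_subst_regressable {Γ : List Srt} {F : L.RelFl} {ts : Asg (Term L Γ) (L.relArgs F)}
    {α : Term L Γ .act} {σ : Term L Γ .sit} (h : (Atom.rel F ts (.doAct α σ)).Regressable) :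
    ((D.relSSA F).subst (Asg.cons σ (Asg.cons α ts))).Regressable := by
  have h := h.1
  simp only [Atom.Mentions, Term.Mentions, not_or, not_exists] at h
  exact Fml.regressable_subst (Asg.cons_forall (p := fun s t => ¬ Term.Mentions IsSitVar t) h.2.2.2
    (Asg.cons_forall (p := fun s t => ¬ Term.Mentions IsSitVar t) h.2.2.1 h.1))
    (D.relSSA_uniform F)

theorem funCond_regressable {Γ : List Srt} {s : Srt} {f : FunFl L s}
    {ts : Asg (Term L Γ) f.args} {α : Term L Γ .act} {σ : Term L Γ .sit}
    (h : ¬ (Term.fl f ts (.doAct α σ)).Mentions IsSitVar) :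
    (D.funCond f ts α σ).Regressable := by
  simp only [Term.Mentions, not_or, not_exists] at h
  exact Fml.regressable_subst (Asg.cons_forall (p := fun s t => ¬ Term.Mentions IsSitVar t)
    (by rw [Term.mentions_isSitVar_wk]; exact h.2.2.2.2)
    (Asg.cons_forall (p := fun s t => ¬ Term.Mentions IsSitVar t)
      (by rw [Term.mentions_isSitVar_wk]; exact h.2.2.2.1)
      (Asg.cons_forall (p := fun s t => ¬ Term.Mentions IsSitVar t)
        (Term.not_isSitVar_hd f.sort_ne_sit)
        (fun s v => by rw [Term.mentions_isSitVar_wk]; exact h.2.1 s v))))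
    (D.funSSA_uniform f)

theorem tempCond_regressable {Γ : List Srt} {f : L.TempFl}
    {ts : Asg (Term L Γ) (L.tempArgs f)} {τ : Term L Γ .real} {σ : Term L Γ .sit}
    (h : ¬ (Term.temp f ts τ σ).Mentions IsSitVar) :
    (D.tempCond f ts τ σ).Regressable := by
  simp only [Term.Mentions, not_or, not_exists] at h
  have hts : ∀ s v, ¬ ((ts s v).wk (s' := .real)).Mentions IsSitVar := fun s v => by
    rw [Term.mentions_isSitVar_wk]
    exact h.2.1 s v
  have hτ : ¬ (τ.wk (s' := .real)).Mentions IsSitVar := by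
    rw [Term.mentions_isSitVar_wk]
    exact h.2.2.1
  have hσ : ¬ (σ.wk (s' := .real)).Mentions IsSitVar := by
    rw [Term.mentions_isSitVar_wk]
    exact h.2.2.2
  have hsea := Fml.regressable_subst (Asg.cons_forall (p := fun s t => ¬ Term.Mentions IsSitVar t)
    hσ (Asg.cons_forall (p := fun s t => ¬ Term.Mentions IsSitVar t)
      (Term.not_isSitVar_hd (s := .real) (by simp))
      (Asg.cons_forall (p := fun s t => ¬ Term.Mentions IsSitVar t) hτ hts)))
    (D.sea_uniform f)
  have h1 : (Fml.eq (τ.wk (s' := .real)) (.start σ.wk)).Regressable :=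
    ⟨by simp [Atom.Mentions, Term.Mentions, hτ, hσ, IsSitVar], by simp⟩
  refine ⟨⟨h1, ?_, by simp⟩, h1, hsea⟩
  simp only [Atom.Mentions, Term.Mentions, not_or, not_exists]
  exact ⟨Term.not_isSitVar_hd (by simp), by simp [IsSitVar], hts, hσ⟩

theorem repl_hd_regressable {Γ : List Srt} {W : Atom L Γ} (hW : W.NotPoss) (h : W.Regressable)
    {s : Srt} (hs : s ≠ .sit) (u : Term L Γ s) : (W.wk.repl u.wk hd).Regressable :=
  Atom.regressable_repl (Term.not_isSitVar_hd hs) (Atom.regressable_wk h hW) hW.wk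

/-- Regression of a regressable formula leads to a formula about the initial situation that mentions
no temporal fluent. -/
theorem Regr.uniform {Γ : List Srt} {W V : Fml L Γ} (h : D.Regr W V) (hW : W.Regressable) :
    V.Uniform .S0 ∧ ∀ f : L.TempFl, ¬ V.MentionsTemp f := by
  induction h with
  | base a hu ht => exact ⟨hu, ht⟩
  | poss A ts τ σ V h ih => exact ih (pre_subst_regressable hW)
  | rel F ts α σ V h ih => exact ih (relSSA_subst_regressable hW)
  | func W hP f ts α σ hm hts hσ V h ih =>
    exact ih ⟨f.sort_ne_sit, funCond_regressable fun hu => hW.1 (hm.trans hu),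
      repl_hd_regressable hP hW f.sort_ne_sit _⟩
  | temp W hP f ts τ σ hm V h ih =>
    exact ih ⟨by simp, tempCond_regressable fun hu => hW.1 (hm.trans hu),
      repl_hd_regressable hP hW (by simp) _⟩
  | start W hP α σ hm V h ih =>
    refine ih (Atom.regressable_repl (fun hu => hW.1 (hm.trans ?_)) hW hP)
    simp only [Term.Mentions, IsSitVar] at hu ⊢
    grind
  | neg φ V h ih => exact ih hW
  | and φ ψ V V' h h' ih ih' =>
    exact ⟨⟨(ih hW.1).1, (ih' hW.2).1⟩, fun f hf => hf.elim ((ih hW.1).2 f) ((ih' hW.2).2 f)⟩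
  | ex s φ V h ih => exact ⟨⟨hW.1, (ih hW.2).1⟩, (ih hW.2).2⟩

end TemporalBAT

end Regressability

/-! ### Uniform formulas depend only on the state at one situation. -/

section Conservativity

variable {L : Signature}

/-- The map `e` between two structures respects the static symbols, the fluents at the situation `z`
and, among the temporal fluents, those in `T`. -/
structure Sim (M M' : Struct L) (e : ∀ s, M.Dom s → M'.Dom s) (z : M.Sit) (T : L.TempFl → Prop) :
    Prop where
  -- Nothing is required of the map on situations; it may collapse all of them to one point.
  bij : ∀ s, s ≠ .sit → Function.Bijective (e s)
  real : ∀ x : ℝ, e .real x = x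
  fn : ∀ {s} (f : L.Fn s) (x : Asg M.Dom (L.fnArgs f)),
    M'.fn f (fun s v => e s (x s v)) = e s (M.fn f x)
  pred : ∀ (P : L.Pred) (x : Asg M.Dom (L.predArgs P)),
    M'.pred P (fun s v => e s (x s v)) ↔ M.pred P x
  action : ∀ (A : L.Act) (x : Asg M.Dom (L.actArgs A)) (t : ℝ),
    M'.action A (fun s v => e s (x s v)) t = e .act (M.action A x t)
  time : ∀ a : M.Action, M'.time (e .act a) = M.time a
  start : M'.start (e .sit z) = M.start z
  rel : ∀ (F : L.RelFl) (x : Asg M.Dom (L.relArgs F)),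
    M'.rel F (fun s v => e s (x s v)) (e .sit z) ↔ M.rel F x z
  fl : ∀ {s} (f : FunFl L s) (x : Asg M.Dom f.args),
    M'.fl f (fun s v => e s (x s v)) (e .sit z) = e s (M.fl f x z)
  temp : ∀ f, T f → ∀ (x : Asg M.Dom (L.tempArgs f)) (t : ℝ),
    M'.temp f (fun s v => e s (x s v)) t (e .sit z) = M.temp f x t z

theorem Term.Uniform.eq_of_sit {Γ : List Srt} {t σ : Term L Γ .sit} (h : t.Uniform σ) : t = σ := by
  by_contra hne
  refine h (Term.mentions_self ⟨rfl, fun hs => hne ?_⟩)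
  obtain ⟨_, rfl⟩ := hs
  rfl

/-- By uniformity every situation term that occurs is `σ` itself, so fluents are only read at `z`
and the induction never descends into a situation term. -/
theorem Sim.term_eval {M M' : Struct L} {e : ∀ s, M.Dom s → M'.Dom s} {z : M.Sit}
    {T : L.TempFl → Prop} (h : Sim M M' e z T) {Γ : List Srt} {ρ : Asg M.Dom Γ}
    {σ : Term L Γ .sit} (hσ : σ.eval M ρ = z) (hσ' : σ.eval M' (fun s v => e s (ρ s v)) = e .sit z)
    {s : Srt} (t : Term L Γ s) (ht : t.Uniform σ) (hT : ∀ f, t.Mentions (IsTemp f) → T f) :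
    t.eval M' (fun s v => e s (ρ s v)) = e s (t.eval M ρ) := by
  have sit : ∀ t : Term L Γ .sit, t.Uniform σ → t.eval M' (fun s v => e s (ρ s v)) = e .sit z ∧
      t.eval M ρ = z := fun t ht => by
    rw [ht.eq_of_sit]
    exact ⟨hσ', hσ⟩
  induction t with
  | var v => rfl
  | S0 =>
    obtain ⟨h1, h2⟩ := sit _ ht
    rw [h1, h2]
  | doAct α τ =>
    obtain ⟨h1, h2⟩ := sit _ ht
    rw [h1, h2]
  | fn f ts ih =>
    simp only [Term.Uniform, Term.Mentions, not_or, not_exists] at ht hT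
    simp only [Term.eval]
    rw [← h.fn]
    congr 1
    funext s v
    exact ih s v (ht.2 s v) fun f hf => hT f (.inr ⟨s, v, hf⟩)
  | rfn f ts ih =>
    simp only [Term.Uniform, Term.Mentions, not_or, not_exists] at ht hT
    simp only [Term.eval]
    rw [h.real]
    congr 1
    funext i
    rw [ih i (ht.2 i) fun f hf => hT f (.inr ⟨i, hf⟩), h.real]
  | action A ts τ ih ih' =>
    simp only [Term.Uniform, Term.Mentions, not_or, not_exists] at ht hT
    simp only [Term.eval]
    rw [← h.action, ih' ht.2.2 fun f hf => hT f (.inr (.inr hf)), h.real]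
    congr 1
    funext s v
    exact ih s v (ht.2.1 s v) fun f hf => hT f (.inr (.inl ⟨s, v, hf⟩))
  | fl f ts τ ih =>
    simp only [Term.Uniform, Term.Mentions, not_or, not_exists] at ht hT
    simp only [Term.eval]
    obtain ⟨h1, h2⟩ := sit _ ht.2.2
    rw [h1, h2, ← h.fl]
    congr 1
    funext s v
    exact ih s v (ht.2.1 s v) fun f hf => hT f (.inr (.inl ⟨s, v, hf⟩))
  | temp f ts τ τ' ih ih' =>
    simp only [Term.Uniform, Term.Mentions, not_or, not_exists] at ht hT
    simp only [Term.eval]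
    obtain ⟨h1, h2⟩ := sit _ ht.2.2.2
    rw [h1, h2, h.real, ← h.temp f (hT f (.inl ⟨ts, τ, τ', rfl, rfl⟩)),
      ih' ht.2.2.1 fun f hf => hT f (.inr (.inr (.inl hf))), h.real]
    congr 1
    funext s v
    exact ih s v (ht.2.1 s v) fun f hf => hT f (.inr (.inl ⟨s, v, hf⟩))
  | time α ih =>
    simp only [Term.Uniform, Term.Mentions, not_or] at ht hT
    simp only [Term.eval]
    rw [ih ht.2 fun f hf => hT f (.inr hf), h.real, h.time]
  | start τ ih =>
    simp only [Term.Uniform, Term.Mentions, not_or] at ht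
    simp only [Term.eval]
    obtain ⟨h1, h2⟩ := sit _ ht.2
    rw [h1, h2, h.real, h.start]

theorem Sim.atom_holds {M M' : Struct L} {e : ∀ s, M.Dom s → M'.Dom s} {z : M.Sit}
    {T : L.TempFl → Prop} (h : Sim M M' e z T) {Γ : List Srt} {ρ : Asg M.Dom Γ}
    {σ : Term L Γ .sit} (hσ : σ.eval M ρ = z) (hσ' : σ.eval M' (fun s v => e s (ρ s v)) = e .sit z)
    (a : Atom L Γ) (ha : a.Uniform σ) (hT : ∀ f, a.Mentions (IsTemp f) → T f) :
    a.Holds M' (fun s v => e s (ρ s v)) ↔ a.Holds M ρ := by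
  have key := fun {s} (t : Term L Γ s) => h.term_eval hσ hσ' t
  obtain ⟨hm, hk⟩ := ha
  cases a with
  | @eq s t u =>
    simp only [Atom.Mentions, not_or] at hm hT
    simp only [Atom.Holds]
    rw [key t hm.1 fun f hf => hT f (.inl hf), key u hm.2 fun f hf => hT f (.inr hf)]
    exact (h.bij s hk).1.eq_iff
  | pred P ts =>
    simp only [Atom.Mentions, not_exists] at hm hT
    simp only [Atom.Holds]
    rw [← h.pred]
    refine iff_of_eq (congrArg _ ?_)
    funext s v
    exact key _ (hm s v) fun f hf => hT f ⟨s, v, hf⟩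
  | rrel R ts =>
    simp only [Atom.Mentions, not_exists] at hm hT
    simp only [Atom.Holds]
    refine iff_of_eq (congrArg _ ?_)
    funext i
    rw [key _ (hm i) fun f hf => hT f ⟨i, hf⟩, h.real]
  | rel F ts τ =>
    simp only [Atom.Mentions, not_or, not_exists] at hm hT
    simp only [Atom.Holds]
    rw [Term.Uniform.eq_of_sit hm.2, hσ, hσ', ← h.rel]
    refine iff_of_eq (congrArg (M'.rel F · _) ?_)
    funext s v
    exact key _ (hm.1 s v) fun f hf => hT f (.inl ⟨s, v, hf⟩)
  | poss => exact hk.elim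
  | prec => exact hk.elim

/-- The truth of a formula that is uniform in `σ` only depends on the fluents at `σ`. -/
theorem Sim.holds {M M' : Struct L} {e : ∀ s, M.Dom s → M'.Dom s} {z : M.Sit}
    {T : L.TempFl → Prop} (h : Sim M M' e z T) {Γ : List Srt} (φ : Fml L Γ) (ρ : Asg M.Dom Γ)
    {σ : Term L Γ .sit} (hσ : σ.eval M ρ = z) (hσ' : σ.eval M' (fun s v => e s (ρ s v)) = e .sit z)
    (hφ : φ.Uniform σ) (hT : ∀ f, φ.MentionsTemp f → T f) :
    φ.Holds M' (fun s v => e s (ρ s v)) ↔ φ.Holds M ρ := by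
  induction φ with
  | atom a => exact h.atom_holds hσ hσ' a hφ hT
  | neg φ ih => exact not_congr (ih ρ hσ hσ' hφ hT)
  | and φ ψ ih ih' =>
    exact and_congr (ih ρ hσ hσ' hφ.1 fun f hf => hT f (.inl hf))
      (ih' ρ hσ hσ' hφ.2 fun f hf => hT f (.inr hf))
  | ex s φ ih =>
    have key : ∀ x, φ.Holds M' (Asg.cons (e s x) fun s v => e s (ρ s v)) ↔
        φ.Holds M (Asg.cons x ρ) := fun x => by
      rw [← Asg.map_cons e]
      refine ih _ ?_ ?_ hφ.2 hT
      · rw [Term.eval_wk, hσ]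
      · rw [Asg.map_cons e, Term.eval_wk, hσ']
    exact ((h.bij s hφ.1).2.exists).trans (exists_congr key)

/-- The values of the fluents and of `start` at one situation. -/
structure State (M : Struct L) where
  rel : ∀ F : L.RelFl, Asg M.Dom (L.relArgs F) → Prop
  fl : ∀ {s} (f : FunFl L s), Asg M.Dom f.args → M.Dom s
  temp : ∀ f : L.TempFl, Asg M.Dom (L.tempArgs f) → ℝ → ℝ
  start : ℝ

namespace Struct

/-- The structure `M` with the same state at all situations. -/
abbrev const (M : Struct L) (S : State M) : Struct L :=
  { M with
    rel := fun F x _ => S.rel F x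
    fl := fun f x _ => S.fl f x
    temp := fun f x t _ => S.temp f x t
    start := fun _ => S.start }

theorem nonempty_dom (M : Struct L) (s : Srt) : Nonempty (M.Dom s) :=
  match s with
  | .obj => M.nonempty_obj
  | .act => M.nonempty_action
  | .real => ⟨(0 : ℝ)⟩
  | .sit => ⟨M.S0⟩

/-- The state of `M` at `S0`. -/
def initialState (M : Struct L) : State M where
  rel F x := M.rel F x M.S0
  fl f x := M.fl f x M.S0
  temp f x t := M.temp f x t M.S0
  start := M.start M.S0

end Struct

/-- Change of the domain of situations. -/
def Carrier.map {O A S S' : Type} (e : S → S') : ∀ s, Carrier O A S s → Carrier O A S' s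
  | .obj => id
  | .act => id
  | .real => id
  | .sit => e

theorem Carrier.map_map {O A S S' : Type} (e : S → S') (e' : S' → S) {s : Srt} (hs : s ≠ .sit)
    (x : Carrier O A S s) : Carrier.map e' s (Carrier.map e s x) = x := by
  cases s
  case sit => exact absurd rfl hs
  all_goals rfl

theorem Carrier.map_asg {O A S S' : Type} (e : S → S') (e' : S' → S) {Γ : List Srt}
    (hs : .sit ∉ Γ) (x : Asg (Carrier O A S) Γ) :
    (fun s v => Carrier.map e' s (Carrier.map e s (x s v)) : Asg (Carrier O A S) Γ) = x := by
  funext s v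
  exact Carrier.map_map e e' (fun h => hs (h ▸ v.mem)) _

theorem Carrier.map_bijective {O A S S' : Type} (e : S → S') {s : Srt} (hs : s ≠ .sit) :
    Function.Bijective (Carrier.map (O := O) (A := A) e s) := by
  cases s
  case sit => exact absurd rfl hs
  all_goals exact Function.bijective_id

/-! ### Unrolling a model of the initial theory along sequences of actions. -/

namespace TemporalBAT

variable (D : TemporalBAT L)

theorem Stratified.wellFounded [Finite L.TempFl] {D : TemporalBAT L} (hD : D.Stratified) :
    WellFounded fun f' f => D.Above f f' := by
  have h : IsStrictOrder L.TempFl (Relation.TransGen fun f' f => D.Above f f') :=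
    { irrefl := fun f hf => hD f (Relation.transGen_swap.1 hf)
      trans := fun _ _ _ => Relation.TransGen.trans }
  exact (Finite.wellFounded_of_trans_of_irrefl
    (Relation.TransGen fun f' f => D.Above f f')).mono fun _ _ h => Relation.TransGen.single h

open Classical in
/-- The values of the temporal fluents that obey the state evolution axioms, except that the fluents
in `T` keep their values. -/
noncomputable def evolve (hD : WellFounded fun f' f => D.Above f f') {M : Struct L} (S : State M)
    (T : L.TempFl → Prop) : ∀ f : L.TempFl, Asg M.Dom (L.tempArgs f) → ℝ → ℝ :=
  hD.fix fun f ih x t =>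
    -- At `S0` the fluents that occur in `D.initial` must keep their values from `M`, for otherwise
    -- `D.initial` might fail after unrolling.
    if T f then S.temp f x t
    -- A choice is made because existence and uniqueness of `y` become available only once the
    -- unrolled structure is known to satisfy `D.initial`. The value `0` for fluents not directly
    -- below `f` is harmless, since ψ_f does not mention them.
    else Classical.epsilon fun y : ℝ => (D.sea f).Holds
      (M.const { S with temp := fun g => if hg : D.Above f g then ih g hg else fun _ _ => 0 })
      (Asg.cons (s := .sit) M.S0 (Asg.cons (s := .real) y (Asg.cons (s := .real) t x)))

/-- The state after the action `a` in the state `S`. -/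
noncomputable def progress (hD : WellFounded fun f' f => D.Above f f') {M : Struct L}
    (S : State M) (a : M.Action) : State M :=
  -- Atemporal fluents are computed from the old state `S`. The temporal ones come last, because ψ_f
  -- reads the new values of `start`, `f_init` and the other fluents; their value `0` here is
  -- provisional.
  let S' : State M :=
    { rel := fun F x => (D.relSSA F).Holds (M.const S)
        (Asg.cons (s := .sit) M.S0 (Asg.cons (s := .act) a x))
      fl := fun {s} f x => (@Classical.epsilon _ (M.nonempty_dom s) fun y =>
        (D.funSSA f).Holds (M.const S)
          (Asg.cons (s := .sit) M.S0 (Asg.cons (s := .act) a (Asg.cons (s := s) y x))))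
      temp := fun _ _ _ => 0
      start := M.time a }
  { S' with temp := D.evolve hD S' fun _ => False }

/-- The state after a sequence of actions, the last one first. -/
noncomputable def stateAt (hD : WellFounded fun f' f => D.Above f f') (M : Struct L) :
    List M.Action → State M
  | [] => { M.initialState with
      temp := D.evolve hD M.initialState fun f => ∃ φ ∈ D.initial, φ.MentionsTemp f }
  | a :: l => D.progress hD (stateAt hD M l) a

/-- The order on sequences of actions that is generated by adding an action. -/
def listPrec {A : Type} (l : List A) : List A → Prop
  | [] => False
  | _ :: l' => listPrec l l' ∨ l = l'

/-- The structure with sequences of actions as situations, where the fluents are determined by `M` at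
the initial situation and by the axioms. -/
noncomputable abbrev unroll (hD : WellFounded fun f' f => D.Above f f') (M : Struct L) :
    Struct L where
  Obj := M.Obj
  Action := M.Action
  Sit := List M.Action
  nonempty_obj := M.nonempty_obj
  nonempty_action := M.nonempty_action
  -- No argument and no value of a symbol is of sort `sit`, so `M.S0` and `[]` in `Carrier.map` are
  -- mere placeholders.
  fn f x := Carrier.map (fun _ => []) _ (M.fn f fun s v => Carrier.map (fun _ => M.S0) s (x s v))
  pred P x := M.pred P fun s v => Carrier.map (fun _ => M.S0) s (x s v)
  action A x t := M.action A (fun s v => Carrier.map (fun _ => M.S0) s (x s v)) t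
  rel F x l := (D.stateAt hD M l).rel F fun s v => Carrier.map (fun _ => M.S0) s (x s v)
  fl f x l := Carrier.map (fun _ => []) _
    ((D.stateAt hD M l).fl f fun s v => Carrier.map (fun _ => M.S0) s (x s v))
  temp f x t l := (D.stateAt hD M l).temp f (fun s v => Carrier.map (fun _ => M.S0) s (x s v)) t
  time := M.time
  start l := (D.stateAt hD M l).start
  S0 := []
  doAct a l := a :: l
  -- The axioms do not constrain actions outside the range of the action functions; here they are
  -- impossible.
  poss a l := ∃ A x t, a = M.action A x t ∧ (D.pre A).Holds (M.const (D.stateAt hD M l))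
    (Asg.cons (s := .sit) M.S0 (Asg.cons (s := .real) t x))
  prec := listPrec

variable {D} (hD : WellFounded fun f' f => D.Above f f') (M : Struct L)

/-- Moves a right-hand side between the constant structure in which it was evaluated during the
recursion and the unrolled structure. The hypotheses allow the temporal fluents outside `T` to
differ. -/
theorem sim_const (l : List M.Action) (S : State M) (T : L.TempFl → Prop)
    (hrel : S.rel = (D.stateAt hD M l).rel) (hfl : @S.fl = @(D.stateAt hD M l).fl)
    (hstart : S.start = (D.stateAt hD M l).start)
    (htemp : ∀ f, T f → S.temp f = (D.stateAt hD M l).temp f) :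
    Sim (D.unroll hD M) (M.const S) (Carrier.map fun _ => M.S0) l T where
  bij s hs := Carrier.map_bijective _ hs
  real x := rfl
  fn f x := (Carrier.map_map _ _ (L.fn_ne_sit f) _).symm
  pred P x := Iff.rfl
  action A x t := rfl
  time a := rfl
  start := hstart
  rel F x := iff_of_eq (congrFun (congrFun hrel F) _)
  fl {s} f x := (show S.fl f _ = _ by rw [hfl]).trans
    (Carrier.map_map (fun _ => []) (fun _ => M.S0) f.sort_ne_sit _).symm
  temp f hf x t := congrFun (congrFun (htemp f hf) _) t

theorem sim_initial : Sim (D.unroll hD M) M (Carrier.map fun _ => M.S0) []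
    fun f => ∃ φ ∈ D.initial, φ.MentionsTemp f where
  bij s hs := Carrier.map_bijective _ hs
  real x := rfl
  fn f x := (Carrier.map_map _ _ (L.fn_ne_sit f) _).symm
  pred P x := Iff.rfl
  action A x t := rfl
  time a := rfl
  start := rfl
  rel F x := Iff.rfl
  fl f x := (Carrier.map_map _ _ f.sort_ne_sit _).symm
  temp f hf x t := by
    simp only [stateAt, evolve]
    rw [WellFounded.fix_eq, if_pos hf]
    rfl

theorem sat_unroll (φ : Sentence L) (hφ : φ.Uniform .S0)
    (hT : ∀ f, φ.MentionsTemp f → ∃ φ ∈ D.initial, φ.MentionsTemp f) :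
    (D.unroll hD M).Sat φ ↔ M.Sat φ := by
  have := (sim_initial hD M).holds φ Asg.nil (σ := .S0) rfl rfl hφ hT
  rw [Asg.ext_nil (fun s v => Carrier.map _ s (Asg.nil s v))] at this
  exact this.symm

/-- Has to precede the other axioms: it makes `fun_consistent` and `sea_consistent` applicable to
the unrolled structure. The constant structures need not satisfy `D.initial`, so uniqueness cannot
be obtained in them directly. -/
theorem unaModel_unroll (hM : M.UnaModel D.initial) : (D.unroll hD M).UnaModel D.initial := by
  refine ⟨⟨fun A B hAB x t y t' => hM.1.names_ne A B hAB _ t _ t', fun A x t y t' h => ?_⟩,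
    fun φ hφ => (sat_unroll hD M φ (D.initial_uniform φ hφ) fun f hf => ⟨φ, hφ, hf⟩).2 (hM.2 φ hφ)⟩
  obtain ⟨h1, h2⟩ := hM.1.args_eq A _ t _ t' h
  refine ⟨?_, h2⟩
  rw [← Carrier.map_asg (fun _ => M.S0) (fun _ => []) (L.act_noSit A) x,
    ← Carrier.map_asg (fun _ => M.S0) (fun _ => []) (L.act_noSit A) y]
  funext s v
  exact congrArg (Carrier.map _ s) (congrFun (congrFun h1 s) v)

/-- The chosen value was defined in a constant structure that is correct only for the fluents
directly below `f`; ψ_f mentions no others, so its truth transfers. Existence and uniqueness in the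
unrolled structure then identify the choice. The parameters `S` and `T` cover both the initial
situation and the later ones, where `T` is empty. -/
theorem sea_unroll (hM : M.UnaModel D.initial) (f : L.TempFl) (l : List M.Action)
    (S : State M) (T : L.TempFl → Prop) (hT : ¬ T f)
    (hrel : S.rel = (D.stateAt hD M l).rel) (hfl : @S.fl = @(D.stateAt hD M l).fl)
    (hstart : S.start = (D.stateAt hD M l).start)
    (htemp : (D.stateAt hD M l).temp = D.evolve hD S T)
    (x : Asg (D.unroll hD M).Dom (L.tempArgs f)) (t y : ℝ) :
    (D.unroll hD M).temp f x t l = y ↔ (D.sea f).Holds (D.unroll hD M)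
      (Asg.cons (s := .sit) l (Asg.cons (s := .real) y (Asg.cons (s := .real) t x))) := by
  classical
  set S' : State M := { S with temp := fun g => if D.Above f g then D.evolve hD S T g
    else fun _ _ => 0 } with hS'
  have hsim : Sim (D.unroll hD M) (M.const S') (Carrier.map fun _ => M.S0) l (D.Above f) :=
    sim_const hD M l S' _ hrel hfl hstart fun g hg => by
      rw [htemp, hS']
      exact if_pos hg
  have key : ∀ y : ℝ, (D.sea f).Holds (M.const S')
      (Asg.cons (s := .sit) M.S0 (Asg.cons (s := .real) y (Asg.cons (s := .real) t
        fun s v => Carrier.map (fun _ => M.S0) s (x s v)))) ↔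
      (D.sea f).Holds (D.unroll hD M)
        (Asg.cons (s := .sit) l (Asg.cons (s := .real) y (Asg.cons (s := .real) t x))) :=
    fun y => by
    have := hsim.holds (D.sea f)
      (Asg.cons (s := .sit) l (Asg.cons (s := .real) y (Asg.cons (s := .real) t x)))
      (σ := hd) rfl rfl (D.sea_uniform f) fun g hg => hg
    rw [← this]
    refine iff_of_eq (congrArg (fun ρ => (D.sea f).Holds (M.const S') ρ) ?_)
    funext s v
    cases v with
    | zero => rfl
    | succ v =>
      cases v with
      | zero => rfl
      | succ v => cases v <;> rfl
  obtain ⟨y₀, hy₀, huniq⟩ := D.sea_consistent f _ (unaModel_unroll hD M hM) x t l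
  have hval : (D.unroll hD M).temp f x t l = Classical.epsilon fun y : ℝ =>
      (D.sea f).Holds (M.const S')
      (Asg.cons (s := .sit) M.S0 (Asg.cons (s := .real) y (Asg.cons (s := .real) t
        fun s v => Carrier.map (fun _ => M.S0) s (x s v)))) := by
    show (D.stateAt hD M l).temp f _ t = _
    rw [htemp, evolve, WellFounded.fix_eq, if_neg hT]
    rfl
  have hval' := (key _).1 (Classical.epsilon_spec (p := fun y : ℝ => (D.sea f).Holds (M.const S')
      (Asg.cons (s := .sit) M.S0 (Asg.cons (s := .real) y (Asg.cons (s := .real) t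
        fun s v => Carrier.map (fun _ => M.S0) s (x s v))))) ⟨y₀, (key _).2 hy₀⟩)
  rw [← hval] at hval'
  constructor
  · rintro rfl
    exact hval'
  · intro hy
    exact (huniq _ hval').trans (huniq _ hy).symm

/-- On sequences, second-order induction is induction on lists and injectivity of `do` is that of
`List.cons`. The other axioms hold because the recursion was defined by their right-hand sides. -/
theorem model_unroll (hM : M.UnaModel D.initial) : D.Model (D.unroll hD M) where
  foundational :=
    { do_inj := fun a a' s s' h => by
        injection h with h1 h2
        exact ⟨h1, h2⟩
      induction := fun P h0 h l => by
        induction l with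
        | nil => exact h0
        | cons a l ih => exact h a l ih
      prec_S0 := fun s h => h
      prec_do := fun a s s' => Iff.rfl
      start_do := fun a s => rfl }
  initial := unaModel_unroll hD M hM
  pre A x t l := by
    have hsim := sim_const hD M l _ (fun _ => True) rfl rfl rfl fun _ _ => rfl
    rw [← hsim.holds (D.pre A) (Asg.cons (s := .sit) l (Asg.cons (s := .real) t x)) (σ := hd) rfl rfl
      (D.pre_uniform A) fun _ _ => trivial]
    have hρ : (fun s v => Carrier.map (fun _ => M.S0) s (Asg.cons (X := (D.unroll hD M).Dom)
        (s := .sit) l (Asg.cons (s := .real) t x) s v) : Asg M.Dom _) =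
        Asg.cons (s := .sit) M.S0 (Asg.cons (s := .real) t
          fun s v => Carrier.map (fun _ => M.S0) s (x s v)) := by
      funext s v
      cases v with
      | zero => rfl
      | succ v => cases v <;> rfl
    constructor
    -- By unique names the action determines its symbol and arguments, so the existential in the
    -- definition of `poss` has one witness.
    · rintro ⟨B, x', t', h, h'⟩
      obtain rfl : A = B := by
        by_contra hAB
        exact hM.1.names_ne A B hAB _ _ _ _ h
      obtain ⟨rfl, rfl⟩ := hM.1.args_eq A _ _ _ _ h
      rw [← hρ] at h'
      exact h'
    · intro h
      exact ⟨A, _, t, rfl, hρ ▸ h⟩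
  relSSA F x a l := by
    have hsim := sim_const hD M l _ (fun _ => True) rfl rfl rfl fun _ _ => rfl
    rw [← hsim.holds (D.relSSA F) (Asg.cons (s := .sit) l (Asg.cons (s := .act) a x)) (σ := hd)
      rfl rfl (D.relSSA_uniform F) fun _ _ => trivial]
    refine iff_of_eq (congrArg
      (fun ρ => (D.relSSA F).Holds (M.const (D.stateAt hD M l)) ρ) ?_)
    funext s v
    cases v with
    | zero => rfl
    | succ v => cases v <;> rfl
  funSSA {s} f x y a l := by
    have hsim := sim_const hD M l _ (fun _ => True) rfl rfl rfl fun _ _ => rfl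
    have key : ∀ y : (D.unroll hD M).Dom s,
        (D.funSSA f).Holds (M.const (D.stateAt hD M l))
          (Asg.cons (s := .sit) M.S0 (Asg.cons (s := .act) a
            (Asg.cons (s := s) (Carrier.map (fun _ => M.S0) s y)
            fun s v => Carrier.map (fun _ => M.S0) s (x s v)))) ↔
        (D.funSSA f).Holds (D.unroll hD M)
          (Asg.cons (s := .sit) l (Asg.cons (s := .act) a (Asg.cons (s := s) y x))) := fun y => by
      rw [← hsim.holds (D.funSSA f)
        (Asg.cons (s := .sit) l (Asg.cons (s := .act) a (Asg.cons (s := s) y x))) (σ := hd)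
        rfl rfl (D.funSSA_uniform f) fun _ _ => trivial]
      refine iff_of_eq (congrArg
        (fun ρ => (D.funSSA f).Holds (M.const (D.stateAt hD M l)) ρ) ?_)
      funext s v
      cases v with
      | zero => rfl
      | succ v =>
        cases v with
        | zero => rfl
        | succ v => cases v <;> rfl
    -- As for temporal fluents, existence makes the chosen value a solution and uniqueness makes it
    -- the only one.
    obtain ⟨y₀, hy₀, huniq⟩ := D.fun_consistent f _ (unaModel_unroll hD M hM) x a l
    have hval := Classical.epsilon_spec (p := fun y : M.Dom s =>
      (D.funSSA f).Holds (M.const (D.stateAt hD M l))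
          (Asg.cons (s := .sit) M.S0 (Asg.cons (s := .act) a
            (Asg.cons (s := s) y
            fun s v => Carrier.map (fun _ => M.S0) s (x s v))))) ⟨_, (key _).2 hy₀⟩
    have hval' := (key ((D.unroll hD M).fl f x (a :: l))).1 (by
      rw [Carrier.map_map _ _ f.sort_ne_sit]
      exact hval)
    constructor
    · rintro rfl
      exact hval'
    · intro hy
      exact (huniq _ hval').trans (huniq _ hy).symm
  sea f x t y l := by
    cases l with
    | nil =>
      -- A fluent of the initial theory was not redefined at `S0`; its axiom there is entailed by
      -- the initial theory.
      by_cases hf : ∃ φ ∈ D.initial, φ.MentionsTemp f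
      · exact D.initial_consistent f hf _ (unaModel_unroll hD M hM) x t y
      · exact sea_unroll hD M hM f [] M.initialState _ hf rfl rfl rfl rfl x t y
    | cons a l =>
      exact sea_unroll hD M hM f (a :: l)
        -- This is the provisional state inside `progress` to which `evolve` is applied.
        { D.progress hD (D.stateAt hD M l) a with temp := fun _ _ _ => 0 }
        (fun _ => False) id rfl rfl rfl rfl x t y

/-- Projection reduces to entailment by the initial theory. -/
theorem Regr.entails_iff [Finite L.TempFl] {D : TemporalBAT L} (hD : D.Stratified)
    {W V : Sentence L} (h : D.Regr W V) (hW : W.Regressable) : D.Entails W ↔ D.InitialEntails V := by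
  obtain ⟨hu, ht⟩ := h.uniform hW
  constructor
  -- `W` holds in the unrolled structure, hence so does `V`; as `V` speaks only of `S0` and has no
  -- temporal fluent, it descends to `M`.
  · intro hE M hM
    have hm := model_unroll hD.wellFounded M hM
    exact (sat_unroll hD.wellFounded M V hu fun f hf => absurd hf (ht f)).1
      ((h.sound hm Asg.nil).1 (hE _ hm))
  · intro hE M hM
    exact (h.sound hM Asg.nil).2 (hE M hM.initial)

end TemporalBAT

end Conservativity

/-! ### Weights of terms and their behaviour under replacement. -/

section Termination

variable {L : Signature}

instance Var.finite (Γ : List Srt) : Finite (Σ s, Var Γ s) := by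
  induction Γ with
  | nil =>
    have : IsEmpty (Σ s, Var [] s) := ⟨fun v => nomatch v.2⟩
    infer_instance
  | cons s Γ ih =>
    refine Finite.of_surjective
      (fun o : Option (Σ s, Var Γ s) => o.elim (⟨s, .zero⟩ : Σ s', Var (s :: Γ) s')
        fun v => ⟨v.1, v.2.succ⟩) ?_
    rintro ⟨s', v⟩
    cases v with
    | zero => exact ⟨none, rfl⟩
    | succ v => exact ⟨some ⟨_, v⟩, rfl⟩

noncomputable instance Var.fintype (Γ : List Srt) : Fintype (Σ s, Var Γ s) := Fintype.ofFinite _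

/-- The sum of the values of a function on the variables of a context. -/
noncomputable def sumArgs {Γ : List Srt} (g : ∀ s, Var Γ s → ℕ) : ℕ := ∑ p : Σ s, Var Γ s, g p.1 p.2

theorem le_sumArgs {Γ : List Srt} (g : ∀ s, Var Γ s → ℕ) (s : Srt) (v : Var Γ s) :
    g s v ≤ sumArgs g :=
  Finset.single_le_sum (f := fun p : Σ s, Var Γ s => g p.1 p.2) (fun _ _ => Nat.zero_le _)
    (Finset.mem_univ ⟨s, v⟩)

theorem exists_pos_of_sumArgs_pos {Γ : List Srt} {g : ∀ s, Var Γ s → ℕ} (h : 0 < sumArgs g) :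
    ∃ s v, 0 < g s v := by
  obtain ⟨p, -, hp⟩ := Finset.exists_ne_zero_of_sum_ne_zero h.ne'
  exact ⟨p.1, p.2, Nat.pos_of_ne_zero hp⟩

theorem sumArgs_le {Γ : List Srt} {g g' : ∀ s, Var Γ s → ℕ} (hle : ∀ s v, g s v ≤ g' s v) :
    sumArgs g ≤ sumArgs g' :=
  Finset.sum_le_sum fun p _ => hle p.1 p.2

theorem sumArgs_lt {Γ : List Srt} {g g' : ∀ s, Var Γ s → ℕ} (hle : ∀ s v, g s v ≤ g' s v) {s : Srt}
    {v : Var Γ s} (h : g s v < g' s v) : sumArgs g < sumArgs g' :=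
  Finset.sum_lt_sum (fun p _ => hle p.1 p.2) ⟨⟨s, v⟩, Finset.mem_univ _, h⟩

/-- The number of actions in a situation term. -/
def Term.len {Γ : List Srt} : ∀ {s}, Term L Γ s → ℕ
  | _, .doAct _ σ => σ.len + 1
  | _, _ => 0

variable (r : L.TempFl → ℕ) (K : ℕ)

/-- A measure of the work that regression has to do at a term. It depends on the
number of actions in its situation argument in the first place. -/
def Term.weight {Γ : List Srt} : ∀ {s}, Term L Γ s → ℕ
  -- At one situation `start` is lightest, then atemporal fluents, then temporal fluents by rank. If
  -- `r f + 2 ≤ K`, a temporal fluent at `σ` still weighs less than an atemporal one at `do (α, σ)`.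
  -- Atemporal fluents and `start` at `S0` need no treatment and weigh nothing; temporal fluents
  -- weigh something even there.
  | _, .fl _ _ σ => if σ.len = 0 then 0 else σ.len * K + 1
  | _, .temp f _ _ σ => σ.len * K + 2 + r f
  | _, .start σ => σ.len * K
  | _, _ => 0

/-- The sum of the weights of all occurrences of subterms. -/
noncomputable def Term.size {Γ : List Srt} : ∀ {s}, Term L Γ s → ℕ
  | _, .var _ => 0
  | _, .fn _ ts => sumArgs fun s v => (ts s v).size
  | _, .rfn _ ts => ∑ i, (ts i).size
  | _, .action _ ts τ => (sumArgs fun s v => (ts s v).size) + τ.size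
  | _, .fl f ts σ => Term.weight r K (.fl f ts σ) +
      ((sumArgs fun s v => (ts s v).size) + σ.size)
  | _, .temp f ts τ σ => Term.weight r K (.temp f ts τ σ) +
      ((sumArgs fun s v => (ts s v).size) + τ.size + σ.size)
  | _, .time α => α.size
  | _, .start σ => Term.weight r K (.start σ) + σ.size
  | _, .S0 => 0
  | _, .doAct α σ => α.size + σ.size

/-- The weight of an atom itself, without its terms. -/
def Atom.weight {Γ : List Srt} : Atom L Γ → ℕ
  -- This weight is kept out of `Atom.size`: a relational fluent is unfolded only after its terms
  -- have lost all weight.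
  | .rel _ _ σ => if σ.len = 0 then 0 else σ.len * K + 1
  | _ => 0

/-- The sum of the weights of all occurrences of terms. -/
noncomputable def Atom.size {Γ : List Srt} : Atom L Γ → ℕ
  | .eq t u => t.size r K + u.size r K
  | .pred _ ts => sumArgs fun s v => (ts s v).size r K
  | .rrel _ ts => ∑ i, (ts i).size r K
  | .rel _ ts σ => (sumArgs fun s v => (ts s v).size r K) + σ.size r K
  | .poss α σ => α.size r K + σ.size r K
  | .prec σ σ' => σ.size r K + σ'.size r K

/-- The atom is regressable, is not a `Poss` atom, and all weights are at most `μ`. -/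
structure Atom.Ready {Γ : List Srt} (μ : ℕ) (a : Atom L Γ) : Prop where
  regressable : a.Regressable
  notPoss : a.NotPoss
  terms_le : ¬ a.Mentions fun _ x => μ < x.weight r K
  weight_le : a.weight K ≤ μ

/-- All atoms are ready and there is no quantifier over situations. -/
def Fml.Ready (μ : ℕ) : ∀ {Γ : List Srt}, Fml L Γ → Prop
  | _, .atom a => a.Ready r K μ
  | _, .neg φ => φ.Ready μ
  | _, .and φ ψ => φ.Ready μ ∧ ψ.Ready μ
  | _, .ex s φ => s ≠ .sit ∧ φ.Ready μ

variable {r K}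

theorem Term.weight_le_size {Γ : List Srt} {s : Srt} (t : Term L Γ s) :
    t.weight r K ≤ t.size r K := by
  cases t <;> simp [Term.weight, Term.size]

theorem Term.lt_size_of_mentions {Γ : List Srt} {s : Srt} {t : Term L Γ s} {μ : ℕ}
    (h : t.Mentions fun _ x => μ < x.weight r K) : μ < t.size r K := by
  have hself : ∀ {s} (t : Term L Γ s), μ < t.weight r K → μ < t.size r K :=
    fun t h => h.trans_le t.weight_le_size
  induction t with
  | var | S0 => exact absurd h (Nat.not_lt_zero _)
  | fn f ts ih =>
    rcases h with h | ⟨s, v, h⟩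
    · exact hself _ h
    · exact (ih s v h).trans_le (le_sumArgs (fun s v => (ts s v).size r K) s v)
  | rfn f ts ih =>
    rcases h with h | ⟨i, h⟩
    · exact hself _ h
    · exact (ih i h).trans_le (Finset.single_le_sum (f := fun i => (ts i).size r K)
        (fun _ _ => Nat.zero_le _) (Finset.mem_univ i))
  | action A ts τ ih ih' | fl f ts τ ih ih' =>
    rcases h with h | ⟨s, v, h⟩ | h
    · exact hself _ h
    · have := (ih s v h).trans_le (le_sumArgs (fun s v => (ts s v).size r K) s v)
      simp only [Term.size]
      omega
    · have := ih' h
      simp only [Term.size]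
      omega
  | temp f ts τ σ ih ih' ih'' =>
    rcases h with h | ⟨s, v, h⟩ | h | h
    · exact hself _ h
    · have := (ih s v h).trans_le (le_sumArgs (fun s v => (ts s v).size r K) s v)
      simp only [Term.size]
      omega
    · have := ih' h
      simp only [Term.size]
      omega
    · have := ih'' h
      simp only [Term.size]
      omega
  | time α ih | start σ ih =>
    rcases h with h | h
    · exact hself _ h
    · have := ih h
      simp only [Term.size]
      omega
  | doAct α σ ih ih' =>
    rcases h with h | h | h
    · exact hself _ h
    · have := ih h
      simp only [Term.size]
      omega
    · have := ih' h
      simp only [Term.size]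
      omega

theorem Atom.lt_size_of_mentions {Γ : List Srt} {a : Atom L Γ} {μ : ℕ}
    (h : a.Mentions fun _ x => μ < x.weight r K) : μ < a.size r K := by
  cases a with
  | pred P ts =>
    obtain ⟨s, v, h⟩ := h
    exact (Term.lt_size_of_mentions h).trans_le (le_sumArgs (fun s v => (ts s v).size r K) s v)
  | rrel R ts =>
    obtain ⟨i, h⟩ := h
    exact (Term.lt_size_of_mentions h).trans_le
      (Finset.single_le_sum (f := fun i => (ts i).size r K)
        (fun _ _ => Nat.zero_le _) (Finset.mem_univ i))
  | rel F ts σ =>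
    rcases h with ⟨s, v, h⟩ | h
    · have := (Term.lt_size_of_mentions h).trans_le (le_sumArgs (fun s v => (ts s v).size r K) s v)
      simp only [Atom.size]
      omega
    · have := Term.lt_size_of_mentions h
      simp only [Atom.size]
      omega
  | eq t u | poss t u | prec t u =>
    rcases h with h | h <;>
    · have := Term.lt_size_of_mentions h
      simp only [Atom.size]
      omega

/-- A term of positive size has an innermost subterm of positive weight. -/
theorem Term.exists_innermost {Γ : List Srt} {s : Srt} (t : Term L Γ s) (h : 0 < t.size r K) :
    ∃ (s' : Srt) (u : Term L Γ s'), (t.Mentions fun _ x => u.Same x) ∧ 0 < u.weight r K ∧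
      u.size r K = u.weight r K := by
  have hself : ∀ {s} (t : Term L Γ s), 0 < t.size r K → t.size r K = t.weight r K →
      ∃ (s' : Srt) (u : Term L Γ s'), (t.Mentions fun _ x => u.Same x) ∧ 0 < u.weight r K ∧
      u.size r K = u.weight r K := fun t h h' =>
    ⟨_, t, Term.mentions_self t.same_refl, h' ▸ h, h'⟩
  induction t with
  | var | S0 => exact absurd h (Nat.not_lt_zero _)
  | fn f ts ih =>
    obtain ⟨s, v, hp⟩ := exists_pos_of_sumArgs_pos h
    obtain ⟨s', u, hu, hu'⟩ := ih s v hp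
    exact ⟨s', u, .inr ⟨s, v, hu⟩, hu'⟩
  | rfn f ts ih =>
    obtain ⟨i, -, hi⟩ := Finset.exists_ne_zero_of_sum_ne_zero h.ne'
    obtain ⟨s', u, hu, hu'⟩ := ih i (Nat.pos_of_ne_zero hi)
    exact ⟨s', u, .inr ⟨i, hu⟩, hu'⟩
  | action A ts τ ih ih' | fl f ts τ ih ih' =>
    by_cases h1 : 0 < sumArgs fun s v => (ts s v).size r K
    · obtain ⟨s, v, hp⟩ := exists_pos_of_sumArgs_pos h1
      obtain ⟨s', u, hu, hu'⟩ := ih s v hp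
      exact ⟨s', u, .inr (.inl ⟨s, v, hu⟩), hu'⟩
    by_cases h2 : 0 < τ.size r K
    · obtain ⟨s', u, hu, hu'⟩ := ih' h2
      exact ⟨s', u, .inr (.inr hu), hu'⟩
    refine hself _ h ?_
    simp only [Term.size, Term.weight] at h ⊢
    omega
  | temp f ts τ σ ih ih' ih'' =>
    by_cases h1 : 0 < sumArgs fun s v => (ts s v).size r K
    · obtain ⟨s, v, hp⟩ := exists_pos_of_sumArgs_pos h1
      obtain ⟨s', u, hu, hu'⟩ := ih s v hp
      exact ⟨s', u, .inr (.inl ⟨s, v, hu⟩), hu'⟩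
    by_cases h2 : 0 < τ.size r K
    · obtain ⟨s', u, hu, hu'⟩ := ih' h2
      exact ⟨s', u, .inr (.inr (.inl hu)), hu'⟩
    by_cases h3 : 0 < σ.size r K
    · obtain ⟨s', u, hu, hu'⟩ := ih'' h3
      exact ⟨s', u, .inr (.inr (.inr hu)), hu'⟩
    refine hself _ h ?_
    simp only [Term.size]
    omega
  | time α ih =>
    obtain ⟨s', u, hu, hu'⟩ := ih h
    exact ⟨s', u, .inr hu, hu'⟩
  | start σ ih =>
    by_cases h1 : 0 < σ.size r K
    · obtain ⟨s', u, hu, hu'⟩ := ih h1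
      exact ⟨s', u, .inr hu, hu'⟩
    refine hself _ h ?_
    simp only [Term.size]
    omega
  | doAct α σ ih ih' =>
    by_cases h1 : 0 < α.size r K
    · obtain ⟨s', u, hu, hu'⟩ := ih h1
      exact ⟨s', u, .inr (.inl hu), hu'⟩
    · have h2 : 0 < σ.size r K := by
        simp only [Term.size] at h
        omega
      obtain ⟨s', u, hu, hu'⟩ := ih' h2
      exact ⟨s', u, .inr (.inr hu), hu'⟩

theorem Atom.exists_innermost {Γ : List Srt} (a : Atom L Γ) (h : 0 < a.size r K) :
    ∃ (s' : Srt) (u : Term L Γ s'), (a.Mentions fun _ x => u.Same x) ∧ 0 < u.weight r K ∧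
      u.size r K = u.weight r K := by
  cases a with
  | pred P ts =>
    obtain ⟨s, v, hp⟩ := exists_pos_of_sumArgs_pos (g := fun s v => (ts s v).size r K) h
    obtain ⟨s', u, hu, hu'⟩ := Term.exists_innermost _ hp
    exact ⟨s', u, ⟨s, v, hu⟩, hu'⟩
  | rrel R ts =>
    obtain ⟨i, -, hi⟩ := Finset.exists_ne_zero_of_sum_ne_zero h.ne'
    obtain ⟨s', u, hu, hu'⟩ := Term.exists_innermost _ (Nat.pos_of_ne_zero hi)
    exact ⟨s', u, ⟨i, hu⟩, hu'⟩
  | rel F ts σ =>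
    by_cases h1 : 0 < sumArgs fun s v => (ts s v).size r K
    · obtain ⟨s, v, hp⟩ := exists_pos_of_sumArgs_pos h1
      obtain ⟨s', u, hu, hu'⟩ := Term.exists_innermost _ hp
      exact ⟨s', u, .inl ⟨s, v, hu⟩, hu'⟩
    · have h2 : 0 < σ.size r K := by
        simp only [Atom.size] at h
        omega
      obtain ⟨s', u, hu, hu'⟩ := Term.exists_innermost _ h2
      exact ⟨s', u, .inr hu, hu'⟩
  | eq t t' | poss t t' | prec t t' =>
    by_cases h1 : 0 < t.size r K
    · obtain ⟨s', u, hu, hu'⟩ := Term.exists_innermost _ h1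
      exact ⟨s', u, .inl hu, hu'⟩
    · have h2 : 0 < t'.size r K := by
        simp only [Atom.size] at h
        omega
      obtain ⟨s', u, hu, hu'⟩ := Term.exists_innermost _ h2
      exact ⟨s', u, .inr hu, hu'⟩

/-! ### Weights under renaming and replacement -/

theorem Term.len_wk {Γ : List Srt} {s s' : Srt} (t : Term L Γ s) :
    (t.wk (s' := s')).len = t.len := by
  unfold Term.wk
  induction t <;> simp_all [Term.subst, Term.len, shift]

theorem Term.weight_wk {Γ : List Srt} {s s' : Srt} (t : Term L Γ s) :
    (t.wk (s' := s')).weight r K = t.weight r K := by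
  have h := fun t : Term L Γ .sit => Term.len_wk (s' := s') t
  unfold Term.wk at h ⊢
  cases t <;> simp [Term.subst, Term.weight, shift, h]

theorem Term.size_wk {Γ : List Srt} {s s' : Srt} (t : Term L Γ s) :
    (t.wk (s' := s')).size r K = t.size r K := by
  have h := fun t : Term L Γ .sit => Term.len_wk (s' := s') t
  unfold Term.wk at h ⊢
  induction t <;> simp_all [Term.subst, Term.size, shift, Term.weight]

theorem Atom.size_wk {Γ : List Srt} {s' : Srt} (a : Atom L Γ) :
    (a.wk (s' := s')).size r K = a.size r K := by
  have h := fun {s} (t : Term L Γ s) => Term.size_wk (r := r) (K := K) (s' := s') t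
  unfold Term.wk at h
  cases a <;> simp [Atom.wk, Atom.subst, Atom.size, h]

theorem Atom.weight_wk {Γ : List Srt} {s' : Srt} (a : Atom L Γ) :
    (a.wk (s' := s')).weight K = a.weight K := by
  have h := fun t : Term L Γ .sit => Term.len_wk (s' := s') t
  unfold Term.wk at h
  cases a <;> simp [Atom.wk, Atom.subst, Atom.weight, h]

theorem Atom.Ready.wk {Γ : List Srt} {s' : Srt} {μ : ℕ} {a : Atom L Γ} (h : a.Ready r K μ) :
    (a.wk (s' := s')).Ready r K μ where
  regressable := Atom.regressable_wk h.regressable h.notPoss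
  notPoss := h.notPoss.wk
  terms_le := by
    rw [Atom.mentions_wk]
    simp only [Term.weight_wk]
    exact h.terms_le
  weight_le := (Atom.weight_wk a).trans_le h.weight_le

theorem Term.same_wk {Γ : List Srt} {s s₁ s' : Srt} {t : Term L Γ s} {x : Term L Γ s₁}
    (h : t.Same x) : (t.wk (s' := s')).Same (x.wk (s' := s')) := by
  obtain ⟨rfl, rfl⟩ := h
  exact Term.same_refl _

theorem Atom.Mentions.mono {Γ : List Srt} {p q : ∀ s, Term L Γ s → Prop}
    (hpq : ∀ s x, p s x → q s x) {a : Atom L Γ} (h : a.Mentions p) : a.Mentions q := by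
  have key := fun {s} {t : Term L Γ s} => Term.Mentions.mono hpq (t := t)
  cases a <;> simp only [Atom.Mentions] at h ⊢ <;> grind

theorem Term.len_of_ne_sit {Γ : List Srt} {s : Srt} (hs : s ≠ .sit) (t : Term L Γ s) :
    t.len = 0 := by
  cases t <;> first | rfl | exact absurd rfl hs

theorem Term.ifSame_of_same {Γ : List Srt} {s : Srt} (t u y : Term L Γ s) :
    Term.ifSame t u t y = u :=
  dif_pos t.same_refl

theorem Term.ifSame_of_not {Γ : List Srt} {s s' : Srt} {t : Term L Γ s} {x : Term L Γ s'}
    (h : ¬ t.Same x) (u : Term L Γ s) (y : Term L Γ s') : Term.ifSame t u x y = y :=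
  dif_neg h

/-- Only situation terms have positive length, and the replaced term is not one. So weights, which
depend on lengths alone, do not change around a replaced occurrence. -/
theorem Term.len_repl {Γ : List Srt} {s s' : Srt} (hs : s ≠ .sit) (t u : Term L Γ s)
    (x : Term L Γ s') : (Term.repl t u x).len = x.len := by
  have key : ∀ {s'} (x y : Term L Γ s'), y.len = x.len → (Term.ifSame t u x y).len = x.len :=
      fun x y h => by
    by_cases hx : t.Same x
    · obtain ⟨rfl, rfl⟩ := hx
      rw [Term.len_of_ne_sit hs, Term.len_of_ne_sit hs]
    · rw [Term.ifSame_of_not hx, h]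
  induction x <;> rw [Term.repl] <;> apply key <;> simp_all [Term.len]

theorem Term.size_repl_le {Γ : List Srt} {s s' : Srt} (hs : s ≠ .sit) (t : Term L Γ s)
    {u : Term L Γ s} (hu : u.size r K = 0) (x : Term L Γ s') :
    (Term.repl t u x).size r K ≤ x.size r K := by
  have key : ∀ {s'} (x y : Term L Γ s'), y.size r K ≤ x.size r K →
      (Term.ifSame t u x y).size r K ≤ x.size r K := fun x y h => by
    by_cases hx : t.Same x
    · obtain ⟨rfl, rfl⟩ := hx
      rw [Term.ifSame_of_same, hu]
      exact Nat.zero_le _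
    · rw [Term.ifSame_of_not hx]
      exact h
  induction x with
  | var | S0 => exact key _ _ le_rfl
  | fn f ts ih =>
    exact key _ _ (sumArgs_le fun s v => ih s v)
  | rfn f ts ih =>
    exact key _ _ (Finset.sum_le_sum fun i _ => ih i)
  | action A ts τ ih ih' =>
    exact key _ _ (add_le_add (sumArgs_le fun s v => ih s v) ih')
  | fl f ts σ ih ih' =>
    refine key _ _ (add_le_add ?_ (add_le_add (sumArgs_le fun s v => ih s v) ih'))
    simp only [Term.weight, Term.len_repl hs, le_refl]
  | temp f ts τ σ ih ih' ih'' =>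
    refine key _ _ (add_le_add ?_
      (add_le_add (add_le_add (sumArgs_le fun s v => ih s v) ih') ih''))
    simp only [Term.weight, Term.len_repl hs, le_refl]
  | time α ih => exact key _ _ ih
  | start σ ih =>
    refine key _ _ (add_le_add ?_ ih)
    simp only [Term.weight, Term.len_repl hs, le_refl]
  | doAct α σ ih ih' => exact key _ _ (add_le_add ih ih')

/-- Every occurrence of `t` contributes at least its positive weight and is exchanged for a term
that contributes nothing; by `len_repl` the surrounding weights stay the same. -/
theorem Term.size_repl_lt {Γ : List Srt} {s s' : Srt} (hs : s ≠ .sit) {t u : Term L Γ s}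
    (ht : 0 < t.weight r K) (hu : u.size r K = 0) {x : Term L Γ s'}
    (hx : x.Mentions fun _ z => t.Same z) : (Term.repl t u x).size r K < x.size r K := by
  have hle := fun {s'} (x : Term L Γ s') => Term.size_repl_le hs t hu x
  have key : ∀ {s'} (x y : Term L Γ s'), (¬ t.Same x → y.size r K < x.size r K) →
      (Term.ifSame t u x y).size r K < x.size r K := fun x y h => by
    by_cases hx : t.Same x
    · obtain ⟨rfl, rfl⟩ := hx
      rw [Term.ifSame_of_same, hu]
      exact ht.trans_le (Term.weight_le_size _)
    · rw [Term.ifSame_of_not hx]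
      exact h hx
  induction x with
  | var | S0 => exact key _ _ fun hn => absurd hx hn
  | fn f ts ih =>
    refine key _ _ fun hn => ?_
    obtain ⟨s, v, h⟩ := hx.resolve_left hn
    exact sumArgs_lt (fun s v => hle _) (ih s v h)
  | rfn f ts ih =>
    refine key _ _ fun hn => ?_
    obtain ⟨i, h⟩ := hx.resolve_left hn
    exact Finset.sum_lt_sum (fun i _ => hle _) ⟨i, Finset.mem_univ _, ih i h⟩
  | action A ts τ ih ih' =>
    refine key _ _ fun hn => ?_
    rcases hx.resolve_left hn with ⟨s, v, h⟩ | h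
    · exact add_lt_add_of_lt_of_le (sumArgs_lt (fun s v => hle _) (ih s v h)) (hle _)
    · exact add_lt_add_of_le_of_lt (sumArgs_le fun s v => hle _) (ih' h)
  | fl f ts σ ih ih' =>
    refine key _ _ fun hn => add_lt_add_of_le_of_lt ?_ ?_
    · simp only [Term.weight, Term.len_repl hs, le_refl]
    rcases hx.resolve_left hn with ⟨s, v, h⟩ | h
    · exact add_lt_add_of_lt_of_le (sumArgs_lt (fun s v => hle _) (ih s v h)) (hle _)
    · exact add_lt_add_of_le_of_lt (sumArgs_le fun s v => hle _) (ih' h)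
  | temp f ts τ σ ih ih' ih'' =>
    refine key _ _ fun hn => add_lt_add_of_le_of_lt ?_ ?_
    · simp only [Term.weight, Term.len_repl hs, le_refl]
    rcases hx.resolve_left hn with ⟨s, v, h⟩ | h | h
    · exact add_lt_add_of_lt_of_le (add_lt_add_of_lt_of_le
        (sumArgs_lt (fun s v => hle _) (ih s v h)) (hle _)) (hle _)
    · exact add_lt_add_of_lt_of_le (add_lt_add_of_le_of_lt
        (sumArgs_le fun s v => hle _) (ih' h)) (hle _)
    · exact add_lt_add_of_le_of_lt (add_le_add (sumArgs_le fun s v => hle _) (hle _))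
        (ih'' h)
  | time α ih => exact key _ _ fun hn => ih (hx.resolve_left hn)
  | start σ ih =>
    refine key _ _ fun hn => add_lt_add_of_le_of_lt ?_ (ih (hx.resolve_left hn))
    simp only [Term.weight, Term.len_repl hs, le_refl]
  | doAct α σ ih ih' =>
    refine key _ _ fun hn => ?_
    rcases hx.resolve_left hn with h | h
    · exact add_lt_add_of_lt_of_le (ih h) (hle _)
    · exact add_lt_add_of_le_of_lt (hle _) (ih' h)

theorem Atom.size_repl_lt {Γ : List Srt} {s : Srt} (hs : s ≠ .sit) {t u : Term L Γ s}
    (ht : 0 < t.weight r K) (hu : u.size r K = 0) {a : Atom L Γ}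
    (ha : a.Mentions fun _ z => t.Same z) : (a.repl t u).size r K < a.size r K := by
  have hle := fun {s'} (x : Term L Γ s') => Term.size_repl_le hs t hu x
  have hlt := fun {s'} {x : Term L Γ s'} => Term.size_repl_lt hs ht hu (x := x)
  cases a with
  | pred P ts =>
    obtain ⟨s, v, h⟩ := ha
    exact sumArgs_lt (fun s v => hle _) (hlt h)
  | rrel R ts =>
    obtain ⟨i, h⟩ := ha
    exact Finset.sum_lt_sum (fun i _ => hle _) ⟨i, Finset.mem_univ _, hlt h⟩
  | rel F ts σ =>
    rcases ha with ⟨s, v, h⟩ | h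
    · exact add_lt_add_of_lt_of_le (sumArgs_lt (fun s v => hle _) (hlt h)) (hle _)
    · exact add_lt_add_of_le_of_lt (sumArgs_le fun s v => hle _) (hlt h)
  | eq x y | poss x y | prec x y =>
    rcases ha with h | h
    · exact add_lt_add_of_lt_of_le (hlt h) (hle _)
    · exact add_lt_add_of_le_of_lt (hle _) (hlt h)

theorem Term.not_mentions_of_size_eq_zero {Γ : List Srt} {s : Srt} {t : Term L Γ s}
    (h : t.size r K = 0) (μ : ℕ) : ¬ t.Mentions fun _ x => μ < x.weight r K := fun hm =>
  absurd (Term.lt_size_of_mentions hm) (by omega)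

theorem Term.terms_le_repl {Γ : List Srt} {s s' : Srt} (hs : s ≠ .sit) (t : Term L Γ s)
    {u : Term L Γ s} (hu : u.size r K = 0) {μ : ℕ} (x : Term L Γ s')
    (hx : ¬ x.Mentions fun _ z => μ < z.weight r K) :
    ¬ (Term.repl t u x).Mentions fun _ z => μ < z.weight r K := by
  have key : ∀ {s'} (x y : Term L Γ s'), (¬ y.Mentions fun _ z => μ < z.weight r K) →
      ¬ (Term.ifSame t u x y).Mentions fun _ z => μ < z.weight r K := fun x y hy h =>
    (Term.mentions_ifSame _ _ _ _ h).elim (Term.not_mentions_of_size_eq_zero hu μ) hy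
  induction x with
  | var | S0 => exact key _ _ hx
  | fn f ts ih =>
    simp only [Term.Mentions, not_or, not_exists] at hx
    refine key _ _ ?_
    simp only [Term.Mentions, not_or, not_exists]
    exact ⟨hx.1, fun s v => ih s v (hx.2 s v)⟩
  | rfn f ts ih =>
    simp only [Term.Mentions, not_or, not_exists] at hx
    refine key _ _ ?_
    simp only [Term.Mentions, not_or, not_exists]
    exact ⟨hx.1, fun i => ih i (hx.2 i)⟩
  | action A ts τ ih ih' =>
    simp only [Term.Mentions, not_or, not_exists] at hx
    refine key _ _ ?_
    simp only [Term.Mentions, not_or, not_exists]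
    exact ⟨hx.1, fun s v => ih s v (hx.2.1 s v), ih' hx.2.2⟩
  | fl f ts σ ih ih' =>
    simp only [Term.Mentions, not_or, not_exists] at hx
    refine key _ _ ?_
    simp only [Term.Mentions, not_or, not_exists]
    refine ⟨?_, fun s v => ih s v (hx.2.1 s v), ih' hx.2.2⟩
    simp only [Term.weight, Term.len_repl hs]
    exact hx.1
  | temp f ts τ σ ih ih' ih'' =>
    simp only [Term.Mentions, not_or, not_exists] at hx
    refine key _ _ ?_
    simp only [Term.Mentions, not_or, not_exists]
    refine ⟨?_, fun s v => ih s v (hx.2.1 s v), ih' hx.2.2.1, ih'' hx.2.2.2⟩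
    simp only [Term.weight, Term.len_repl hs]
    exact hx.1
  | time α ih =>
    simp only [Term.Mentions, not_or] at hx
    refine key _ _ ?_
    simp only [Term.Mentions, not_or]
    exact ⟨hx.1, ih hx.2⟩
  | start σ ih =>
    simp only [Term.Mentions, not_or] at hx
    refine key _ _ ?_
    simp only [Term.Mentions, not_or]
    refine ⟨?_, ih hx.2⟩
    simp only [Term.weight, Term.len_repl hs]
    exact hx.1
  | doAct α σ ih ih' =>
    simp only [Term.Mentions, not_or] at hx
    refine key _ _ ?_
    simp only [Term.Mentions, not_or]
    exact ⟨hx.1, ih hx.2.1, ih' hx.2.2⟩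

theorem Atom.Ready.repl {Γ : List Srt} {s : Srt} (hs : s ≠ .sit) {t u : Term L Γ s}
    (hu : u.size r K = 0) (hv : ¬ u.Mentions IsSitVar) {μ : ℕ} {a : Atom L Γ}
    (h : a.Ready r K μ) : (a.repl t u).Ready r K μ where
  regressable := Atom.regressable_repl hv h.regressable h.notPoss
  notPoss := h.notPoss.repl
  terms_le := by
    have key := fun {s'} (x : Term L Γ s') => Term.terms_le_repl hs t hu (μ := μ) x
    have h := h.terms_le
    cases a <;> simp_all [Atom.repl, Atom.Mentions]
  weight_le := by
    have hl := fun x : Term L Γ .sit => Term.len_repl hs t u x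
    have h := h.weight_le
    cases a <;> simp_all [Atom.repl, Atom.weight]

end Termination

/-! ### Existence of a regression. -/

section Existence

variable {L : Signature} {r : L.TempFl → ℕ} {K : ℕ}

theorem Term.subst_subst {Γ Δ Θ : List Srt} (θ : Asg (Term L Δ) Γ) (η : Asg (Term L Θ) Δ) {s : Srt}
    (t : Term L Γ s) : (t.subst θ).subst η = t.subst fun s v => (θ s v).subst η := by
  induction t <;> simp_all [Term.subst]

theorem Term.wk_subst_lift {Γ Δ : List Srt} (θ : Asg (Term L Δ) Γ) {s s' : Srt} (t : Term L Γ s) :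
    (t.wk (s' := s')).subst (Asg.cons hd fun _ v => (θ _ v).wk) = (t.subst θ).wk := by
  unfold Term.wk
  rw [Term.subst_subst, Term.subst_subst]
  rfl

/-- The source of all bounds on unfolded axioms: when weightless terms are substituted into a
uniform term, weight arises only at the single situation `σ.subst θ`, at most `len * K + 1` from
`start` and atemporal fluents, and `len * K + 2 + r f` from `f`. -/
theorem Term.terms_le_subst {Γ Δ : List Srt} {θ : Asg (Term L Δ) Γ}
    (hθ : ∀ s v, (θ s v).size r K = 0) {σ : Term L Γ .sit} (hσ : (σ.subst θ).size r K = 0)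
    {μ : ℕ} (hμ : (σ.subst θ).len * K + 1 ≤ μ) {s : Srt} (t : Term L Γ s) (ht : t.Uniform σ)
    (hT : ∀ f, t.Mentions (IsTemp f) → (σ.subst θ).len * K + 2 + r f ≤ μ) :
    ¬ (t.subst θ).Mentions fun _ x => μ < x.weight r K := by
  have sit : ∀ t : Term L Γ .sit, t.Uniform σ →
      ¬ (t.subst θ).Mentions fun _ x => μ < x.weight r K := fun t ht => by
    rw [ht.eq_of_sit]
    exact Term.not_mentions_of_size_eq_zero hσ μ
  induction t with
  | var v => exact Term.not_mentions_of_size_eq_zero (hθ _ v) μ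
  | S0 => exact sit _ ht
  | doAct α τ => exact sit _ ht
  | fn f ts ih =>
    simp only [Term.Uniform, Term.Mentions, not_or, not_exists] at ht hT
    simp only [Term.subst, Term.Mentions, not_or, not_exists]
    exact ⟨Nat.not_lt_zero _, fun s v => ih s v (ht.2 s v) fun f hf => hT f (.inr ⟨s, v, hf⟩)⟩
  | rfn f ts ih =>
    simp only [Term.Uniform, Term.Mentions, not_or, not_exists] at ht hT
    simp only [Term.subst, Term.Mentions, not_or, not_exists]
    exact ⟨Nat.not_lt_zero _, fun i => ih i (ht.2 i) fun f hf => hT f (.inr ⟨i, hf⟩)⟩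
  | action A ts τ ih ih' =>
    simp only [Term.Uniform, Term.Mentions, not_or, not_exists] at ht hT
    simp only [Term.subst, Term.Mentions, not_or, not_exists]
    exact ⟨Nat.not_lt_zero _,
      fun s v => ih s v (ht.2.1 s v) fun f hf => hT f (.inr (.inl ⟨s, v, hf⟩)),
      ih' ht.2.2 fun f hf => hT f (.inr (.inr hf))⟩
  | fl f ts τ ih =>
    simp only [Term.Uniform, Term.Mentions, not_or, not_exists] at ht hT
    simp only [Term.subst, Term.Mentions, not_or, not_exists]
    refine ⟨?_, fun s v => ih s v (ht.2.1 s v) fun f hf => hT f (.inr (.inl ⟨s, v, hf⟩)),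
      sit _ ht.2.2⟩
    simp only [Term.weight]
    rw [Term.Uniform.eq_of_sit ht.2.2]
    split <;> omega
  | temp f ts τ τ' ih ih' =>
    simp only [Term.Uniform, Term.Mentions, not_or, not_exists] at ht hT
    simp only [Term.subst, Term.Mentions, not_or, not_exists]
    refine ⟨?_, fun s v => ih s v (ht.2.1 s v) fun f hf => hT f (.inr (.inl ⟨s, v, hf⟩)),
      ih' ht.2.2.1 fun f hf => hT f (.inr (.inr (.inl hf))), sit _ ht.2.2.2⟩
    have := hT f (.inl ⟨ts, τ, τ', rfl, rfl⟩)
    simp only [Term.weight]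
    rw [Term.Uniform.eq_of_sit ht.2.2.2]
    omega
  | time α ih =>
    simp only [Term.Uniform, Term.Mentions, not_or] at ht hT
    simp only [Term.subst, Term.Mentions, not_or]
    exact ⟨Nat.not_lt_zero _, ih ht.2 fun f hf => hT f (.inr hf)⟩
  | start τ ih =>
    simp only [Term.Uniform, Term.Mentions, not_or] at ht
    simp only [Term.subst, Term.Mentions, not_or]
    refine ⟨?_, sit _ ht.2⟩
    simp only [Term.weight]
    rw [Term.Uniform.eq_of_sit ht.2]
    omega

theorem Atom.ready_subst {Γ Δ : List Srt} {θ : Asg (Term L Δ) Γ}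
    (hθ : ∀ s v, (θ s v).size r K = 0) (hv : ∀ s v, ¬ (θ s v).Mentions IsSitVar)
    {σ : Term L Γ .sit} (hσ : (σ.subst θ).size r K = 0)
    {μ : ℕ} (hμ : (σ.subst θ).len * K + 1 ≤ μ) (a : Atom L Γ) (ha : a.Uniform σ)
    (hT : ∀ f, a.Mentions (IsTemp f) → (σ.subst θ).len * K + 2 + r f ≤ μ) :
    (a.subst θ).Ready r K μ := by
  have key := fun {s} (t : Term L Γ s) => Term.terms_le_subst hθ hσ hμ t
  refine ⟨Atom.regressable_subst hv ha, ?_, ?_, ?_⟩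
  · have h := ha.2
    cases a <;> trivial
  · obtain ⟨hm, -⟩ := ha
    cases a with
    | pred P ts =>
      simp only [Atom.Mentions, not_exists] at hm hT
      simp only [Atom.subst, Atom.Mentions, not_exists]
      exact fun s v => key _ (hm s v) fun f hf => hT f ⟨s, v, hf⟩
    | rrel R ts =>
      simp only [Atom.Mentions, not_exists] at hm hT
      simp only [Atom.subst, Atom.Mentions, not_exists]
      exact fun i => key _ (hm i) fun f hf => hT f ⟨i, hf⟩
    | rel F ts τ =>
      simp only [Atom.Mentions, not_or, not_exists] at hm hT
      simp only [Atom.subst, Atom.Mentions, not_or, not_exists]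
      exact ⟨fun s v => key _ (hm.1 s v) fun f hf => hT f (.inl ⟨s, v, hf⟩),
        key _ hm.2 fun f hf => hT f (.inr hf)⟩
    | eq t u | poss t u | prec t u =>
      simp only [Atom.Mentions, not_or] at hm hT
      simp only [Atom.subst, Atom.Mentions, not_or]
      exact ⟨key _ hm.1 fun f hf => hT f (.inl hf), key _ hm.2 fun f hf => hT f (.inr hf)⟩
  · cases a with
    | rel F ts τ =>
      have hm := ha.1
      simp only [Atom.Mentions, not_or, not_exists] at hm
      simp only [Atom.subst, Atom.weight]
      rw [Term.Uniform.eq_of_sit hm.2]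
      split <;> omega
    | _ => exact Nat.zero_le _

theorem Fml.ready_subst {Γ Δ : List Srt} {θ : Asg (Term L Δ) Γ}
    (hθ : ∀ s v, (θ s v).size r K = 0) (hv : ∀ s v, ¬ (θ s v).Mentions IsSitVar)
    {σ : Term L Γ .sit} (hσ : (σ.subst θ).size r K = 0)
    {μ : ℕ} (hμ : (σ.subst θ).len * K + 1 ≤ μ) (φ : Fml L Γ) (hφ : φ.Uniform σ)
    (hT : ∀ f, φ.MentionsTemp f → (σ.subst θ).len * K + 2 + r f ≤ μ) :
    (φ.subst θ).Ready r K μ := by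
  induction φ generalizing Δ with
  | atom a => exact Atom.ready_subst hθ hv hσ hμ a hφ hT
  | neg φ ih => exact ih hθ hv hσ hμ hφ hT
  | and φ ψ ih ih' =>
    exact ⟨ih hθ hv hσ hμ hφ.1 fun f hf => hT f (.inl hf),
      ih' hθ hv hσ hμ hφ.2 fun f hf => hT f (.inr hf)⟩
  | ex s φ ih =>
    refine ⟨hφ.1, ih (Asg.cons_forall (p := fun _ t => Term.size r K t = 0) rfl
      fun s v => (Term.size_wk _).trans (hθ s v)) (lift_noSitVar hv hφ.1) ?_ ?_ hφ.2 ?_⟩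
    · rw [Term.wk_subst_lift, Term.size_wk]
      exact hσ
    · rw [Term.wk_subst_lift, Term.len_wk]
      exact hμ
    · rw [Term.wk_subst_lift, Term.len_wk]
      exact hT

theorem Fml.Ready.mono {Γ : List Srt} {μ ν : ℕ} (h : μ ≤ ν) {φ : Fml L Γ}
    (hφ : φ.Ready r K μ) : φ.Ready r K ν := by
  induction φ with
  | atom a =>
    exact ⟨hφ.regressable, hφ.notPoss,
      fun hm => hφ.terms_le (hm.mono fun _ _ hx => h.trans_lt hx), hφ.weight_le.trans h⟩
  | neg φ ih => exact ih hφ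
  | and φ ψ ih ih' => exact ⟨ih hφ.1, ih' hφ.2⟩
  | ex s φ ih => exact ⟨hφ.1, ih hφ.2⟩

theorem Term.PrimeSit.eq_S0 {Γ : List Srt} {σ : Term L Γ .sit} (h : σ.PrimeSit)
    (hl : σ.len = 0) : σ = .S0 := by
  cases σ with
  | S0 => rfl
  | doAct α σ => exact absurd hl (Nat.succ_ne_zero _)
  | _ => exact h.elim

theorem Term.uniform_S0 {Γ : List Srt} : (Term.S0 : Term L Γ .sit).Uniform .S0 :=
  fun h => h.2 (Term.same_refl _)

/-- Provides the side conditions of rule 4. Among non-situation terms only fluents and `start` take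
situation arguments; without weight there is no temporal fluent, and the remaining ones sit at `S0`.
Positivity of `K` is what gives `start (do (α, σ))` weight. -/
theorem Term.uniform_or_primeSit (hK : 0 < K) {Γ : List Srt} {s : Srt} (t : Term L Γ s)
    (hv : ¬ t.Mentions IsSitVar) (h : ¬ t.Mentions fun _ x => 0 < x.weight r K) :
    (s ≠ .sit → t.Uniform .S0) ∧ (s = .sit → t.PrimeSit) := by
  have args : ∀ {Δ : List Srt} (_ : Srt.sit ∉ Δ) {s} (_ : Var Δ s), s ≠ .sit :=
    fun {_} hΔ {_} v hs => hΔ (hs ▸ v.mem)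
  induction t with
  | var v =>
    constructor
    · exact fun hs h => hs h.1
    · intro hs
      exact absurd ⟨hs, v, rfl⟩ hv
  | S0 => exact ⟨fun hs => absurd rfl hs, fun _ => trivial⟩
  | doAct α σ ih ih' =>
    simp only [Term.Mentions, not_or] at hv h
    exact ⟨fun hs => absurd rfl hs, fun _ =>
      ⟨(ih hv.2.1 h.2.1).1 (by simp), (ih' hv.2.2 h.2.2).2 rfl⟩⟩
  | fn f ts ih =>
    refine ⟨fun hs => ?_, fun hs => absurd hs (L.fn_ne_sit f)⟩
    simp only [Term.Uniform, Term.Mentions, not_or, not_exists] at hv h ⊢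
    exact ⟨fun h => hs h.1, fun s v => (ih s v (hv.2 s v) (h.2 s v)).1 (args (L.fn_noSit f) v)⟩
  | rfn f ts ih =>
    refine ⟨fun hs => ?_, fun hs => by simp at hs⟩
    simp only [Term.Uniform, Term.Mentions, not_or, not_exists] at hv h ⊢
    exact ⟨fun h => hs h.1, fun i => (ih i (hv.2 i) (h.2 i)).1 hs⟩
  | action A ts τ ih ih' =>
    refine ⟨fun hs => ?_, fun hs => by simp at hs⟩
    simp only [Term.Uniform, Term.Mentions, not_or, not_exists] at hv h ⊢
    exact ⟨fun h => hs h.1,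
      fun s v => (ih s v (hv.2.1 s v) (h.2.1 s v)).1 (args (L.act_noSit A) v),
      (ih' hv.2.2 h.2.2).1 (by simp)⟩
  | fl f ts σ ih ih' =>
    refine ⟨fun hs => ?_, fun hs => absurd hs f.sort_ne_sit⟩
    simp only [Term.Uniform, Term.Mentions, not_or, not_exists] at hv h ⊢
    have hσ : σ = .S0 := by
      refine ((ih' hv.2.2 h.2.2).2 rfl).eq_S0 ?_
      have := h.1
      simp only [Term.weight] at this
      split at this <;> omega
    exact ⟨fun h => hs h.1,
      fun s v => (ih s v (hv.2.1 s v) (h.2.1 s v)).1 (args f.args_noSit v),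
      hσ ▸ Term.uniform_S0⟩
  | temp f ts τ σ ih ih' ih'' =>
    simp only [Term.Mentions, not_or] at h
    exact absurd (by simp only [Term.weight]; omega) h.1
  | time α ih =>
    refine ⟨fun hs => ?_, fun hs => by simp at hs⟩
    simp only [Term.Uniform, Term.Mentions, not_or] at hv h ⊢
    exact ⟨fun h => hs h.1, (ih hv.2 h.2).1 (by simp)⟩
  | start σ ih =>
    refine ⟨fun hs => ?_, fun hs => by simp at hs⟩
    simp only [Term.Uniform, Term.Mentions, not_or] at hv h ⊢
    have hσ : σ = .S0 := by
      refine ((ih hv.2 h.2).2 rfl).eq_S0 ?_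
      have := h.1
      simp only [Term.weight, not_lt, Nat.le_zero, Nat.mul_eq_zero] at this
      omega
    exact ⟨fun h => hs h.1, hσ ▸ Term.uniform_S0⟩

theorem weight_pos_of_isTemp {f : L.TempFl} {Γ : List Srt} {s : Srt} {t : Term L Γ s}
    (h : IsTemp f s t) : 0 < t.weight r K := by
  obtain ⟨ts, τ, σ, rfl, rfl⟩ := h
  simp only [Term.weight]
  omega

/-- An atom without positive weights is about the initial situation, unless it is a relational fluent
at a later situation. -/
theorem Atom.uniform_or_rel (hK : 0 < K) {Γ : List Srt} (a : Atom L Γ) (hr : a.Regressable)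
    (hp : a.NotPoss) (h : ¬ a.Mentions fun _ x => 0 < x.weight r K) :
    a.Uniform .S0 ∨ ∃ F ts α σ, a = .rel F ts (.doAct α σ) := by
  have key := fun {s} (t : Term L Γ s) => Term.uniform_or_primeSit (r := r) hK t
  have args : ∀ {Δ : List Srt} (_ : Srt.sit ∉ Δ) {s} (_ : Var Δ s), s ≠ .sit :=
    fun {_} hΔ {_} v hs => hΔ (hs ▸ v.mem)
  obtain ⟨hv, hk⟩ := hr
  cases a with
  | poss => exact hp.elim
  | prec => exact hk.elim
  | eq t u =>
    simp only [Atom.Mentions, not_or] at hv h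
    refine .inl ⟨?_, hk⟩
    simp only [Atom.Mentions, not_or]
    exact ⟨(key t hv.1 h.1).1 hk, (key u hv.2 h.2).1 hk⟩
  | pred P ts =>
    simp only [Atom.Mentions, not_exists] at hv h
    refine .inl ⟨?_, trivial⟩
    simp only [Atom.Mentions, not_exists]
    exact fun s v => (key _ (hv s v) (h s v)).1 (args (L.pred_noSit P) v)
  | rrel R ts =>
    simp only [Atom.Mentions, not_exists] at hv h
    refine .inl ⟨?_, trivial⟩
    simp only [Atom.Mentions, not_exists]
    exact fun i => (key _ (hv i) (h i)).1 (by simp)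
  | rel F ts σ =>
    simp only [Atom.Mentions, not_or, not_exists] at hv h
    have hσ := (key σ hv.2 h.2).2 rfl
    cases σ with
    | doAct α σ => exact .inr ⟨F, ts, α, σ, rfl⟩
    | S0 =>
      refine .inl ⟨?_, trivial⟩
      simp only [Atom.Mentions, not_or, not_exists]
      exact ⟨fun s v => (key _ (hv.1 s v) (h.1 s v)).1 (args (L.rel_noSit F) v), Term.uniform_S0⟩
    | _ => exact hσ.elim

theorem Fml.exists_ready {Γ : List Srt} {φ ψ : Fml L Γ} {μ ν : ℕ} (h : φ.Ready r K μ)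
    (h' : ψ.Ready r K ν) : ∃ κ, φ.Ready r K κ ∧ ψ.Ready r K κ :=
  ⟨max μ ν, h.mono (le_max_left _ _), h'.mono (le_max_right _ _)⟩

theorem Atom.ready_of_regressable {Γ : List Srt} {a : Atom L Γ} (h : a.Regressable)
    (hp : a.NotPoss) : a.Ready r K (a.size r K + a.weight K) :=
  ⟨h, hp, fun hm => by
    have := Atom.lt_size_of_mentions hm
    omega, Nat.le_add_left _ _⟩

/-- Meant for `Poss` atoms, whose arguments are arbitrary regressable terms. No explicit bound is
needed, because this unfolding happens only once, before the induction on weights. -/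
theorem Fml.exists_ready_subst {Γ Δ : List Srt} {θ : Asg (Term L Δ) Γ}
    (hθ : ∀ s v, ¬ (θ s v).Mentions IsSitVar) {φ : Fml L Γ} {σ : Term L Γ .sit}
    (hφ : φ.Uniform σ) : ∃ μ, (φ.subst θ).Ready r K μ := by
  induction φ generalizing Δ with
  | atom a =>
    refine ⟨_, Atom.ready_of_regressable (Atom.regressable_subst hθ hφ) ?_⟩
    have h := hφ.2
    cases a <;> trivial
  | neg φ ih => exact ih hθ hφ
  | and φ ψ ih ih' =>
    obtain ⟨μ, h⟩ := ih hθ hφ.1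
    obtain ⟨ν, h'⟩ := ih' hθ hφ.2
    exact Fml.exists_ready h h'
  | ex s φ ih =>
    obtain ⟨μ, h⟩ := ih (lift_noSitVar hθ hφ.1) hφ.2
    exact ⟨μ, hφ.1, h⟩

theorem sumArgs_eq_zero {Γ : List Srt} {g : ∀ s, Var Γ s → ℕ} (h : sumArgs g = 0) (s : Srt)
    (v : Var Γ s) : g s v = 0 :=
  Nat.eq_zero_of_le_zero (h ▸ le_sumArgs g s v)

namespace TemporalBAT

variable {D : TemporalBAT L}

theorem exists_regr_of_ready {μ : ℕ}
    (h : ∀ {Γ : List Srt} (W : Atom L Γ), W.Ready r K μ → ∃ V, D.Regr (.atom W) V)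
    {Γ : List Srt} (φ : Fml L Γ) (hφ : φ.Ready r K μ) : ∃ V, D.Regr φ V := by
  induction φ with
  | atom a => exact h a hφ
  | neg φ ih =>
    obtain ⟨V, hV⟩ := ih hφ
    exact ⟨_, .neg _ _ hV⟩
  | and φ ψ ih ih' =>
    obtain ⟨V, hV⟩ := ih hφ.1
    obtain ⟨V', hV'⟩ := ih' hφ.2
    exact ⟨_, .and _ _ _ _ hV hV'⟩
  | ex s φ ih =>
    obtain ⟨V, hV⟩ := ih hφ.2
    exact ⟨_, .ex _ _ _ hV⟩

/-- The bound is one less than the weight of the fluent at `do (α, σ)`; `r f + 2 ≤ K` makes room for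
temporal fluents at `σ`. -/
theorem relSSA_subst_ready (hr : ∀ f, r f + 2 ≤ K) (hK : 0 < K) {Γ : List Srt} {F : L.RelFl}
    {ts : Asg (Term L Γ) (L.relArgs F)} {α : Term L Γ .act} {σ : Term L Γ .sit}
    (h : (Atom.rel F ts (.doAct α σ)).Regressable)
    (hs : (Atom.rel F ts (.doAct α σ)).size r K = 0) :
    ((D.relSSA F).subst (Asg.cons σ (Asg.cons α ts))).Ready r K ((σ.len + 1) * K) := by
  have h := h.1
  simp only [Atom.Mentions, Term.Mentions, not_or, not_exists] at h
  simp only [Atom.size, Term.size, Nat.add_eq_zero_iff] at hs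
  refine Fml.ready_subst (σ := hd)
    (Asg.cons_forall (p := fun _ t => Term.size r K t = 0) hs.2.2
      (Asg.cons_forall (p := fun _ t => Term.size r K t = 0) hs.2.1 (sumArgs_eq_zero hs.1)))
    (Asg.cons_forall (p := fun _ t => ¬ Term.Mentions IsSitVar t) h.2.2.2
      (Asg.cons_forall (p := fun _ t => ¬ Term.Mentions IsSitVar t) h.2.2.1 h.1))
    hs.2.2 ?_ _ (D.relSSA_uniform F) fun f _ => ?_
  · show σ.len * K + 1 ≤ _
    rw [Nat.add_mul]
    omega
  · show σ.len * K + 2 + r f ≤ _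
    have := hr f
    rw [Nat.add_mul]
    omega

theorem funCond_ready (hr : ∀ f, r f + 2 ≤ K) (hK : 0 < K) {Γ : List Srt} {s : Srt} {f : FunFl L s}
    {ts : Asg (Term L Γ) f.args} {α : Term L Γ .act} {σ : Term L Γ .sit}
    (h : ¬ (Term.fl f ts (.doAct α σ)).Mentions IsSitVar)
    (hs : (Term.fl f ts (.doAct α σ)).size r K = (Term.fl f ts (.doAct α σ)).weight r K) :
    (D.funCond f ts α σ).Ready r K ((σ.len + 1) * K) := by
  simp only [Term.Mentions, not_or, not_exists] at h
  simp only [Term.size, Nat.add_eq_left, Nat.add_eq_zero_iff] at hs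
  refine Fml.ready_subst (σ := hd)
    (Asg.cons_forall (p := fun _ t => Term.size r K t = 0) ((Term.size_wk _).trans hs.2.2)
      (Asg.cons_forall (p := fun _ t => Term.size r K t = 0) ((Term.size_wk _).trans hs.2.1)
        (Asg.cons_forall (p := fun _ t => Term.size r K t = 0) rfl
          fun s v => (Term.size_wk _).trans (sumArgs_eq_zero hs.1 s v))))
    (Asg.cons_forall (p := fun _ t => ¬ Term.Mentions IsSitVar t)
      (by rw [Term.mentions_isSitVar_wk]; exact h.2.2.2.2)
      (Asg.cons_forall (p := fun _ t => ¬ Term.Mentions IsSitVar t)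
        (by rw [Term.mentions_isSitVar_wk]; exact h.2.2.2.1)
        (Asg.cons_forall (p := fun _ t => ¬ Term.Mentions IsSitVar t)
          (Term.not_isSitVar_hd f.sort_ne_sit)
          (fun s v => by rw [Term.mentions_isSitVar_wk]; exact h.2.1 s v))))
    ((Term.size_wk _).trans hs.2.2) ?_ _ (D.funSSA_uniform f) fun f _ => ?_
  · show σ.wk.len * K + 1 ≤ _
    rw [Term.len_wk, Nat.add_mul]
    omega
  · show σ.wk.len * K + 2 + r f ≤ _
    have := hr f
    rw [Term.len_wk, Nat.add_mul]
    omega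

/-- The bound is one less than the weight of the fluent term. The situation does not get shorter, so
the descent comes from the rank: `f_init` and `start` lie below all temporal fluents at `σ`, and ψ_f
mentions only fluents of smaller rank. -/
theorem tempCond_ready (hA : ∀ f g, D.Above f g → r g < r f) {Γ : List Srt} {f : L.TempFl}
    {ts : Asg (Term L Γ) (L.tempArgs f)} {τ : Term L Γ .real} {σ : Term L Γ .sit}
    (h : ¬ (Term.temp f ts τ σ).Mentions IsSitVar)
    (hs : (Term.temp f ts τ σ).size r K = (Term.temp f ts τ σ).weight r K) :
    (D.tempCond f ts τ σ).Ready r K (σ.len * K + 1 + r f) := by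
  have hreg := tempCond_regressable (D := D) h
  simp only [Term.Mentions, not_or, not_exists] at h
  simp only [Term.size, Nat.add_eq_left, Nat.add_eq_zero_iff] at hs
  obtain ⟨⟨hs1, hs2⟩, hs3⟩ := hs
  have hsea : ((D.sea f).subst
      (Asg.cons σ.wk (Asg.cons hd (Asg.cons τ.wk fun s v => (ts s v).wk)))).Ready r K
      (σ.len * K + 1 + r f) := by
    refine Fml.ready_subst (σ := hd)
      (Asg.cons_forall (p := fun _ t => Term.size r K t = 0) ((Term.size_wk _).trans hs3)
        (Asg.cons_forall (p := fun _ t => Term.size r K t = 0) rfl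
          (Asg.cons_forall (p := fun _ t => Term.size r K t = 0) ((Term.size_wk _).trans hs2)
          fun s v => (Term.size_wk _).trans (sumArgs_eq_zero hs1 s v))))
      (Asg.cons_forall (p := fun _ t => ¬ Term.Mentions IsSitVar t)
        (by rw [Term.mentions_isSitVar_wk]; exact h.2.2.2)
        (Asg.cons_forall (p := fun _ t => ¬ Term.Mentions IsSitVar t)
          (Term.not_isSitVar_hd (s := .real) (by simp))
          (Asg.cons_forall (p := fun _ t => ¬ Term.Mentions IsSitVar t)
            (by rw [Term.mentions_isSitVar_wk]; exact h.2.2.1)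
            (fun s v => by rw [Term.mentions_isSitVar_wk]; exact h.2.1 s v))))
      ((Term.size_wk _).trans hs3) ?_ _ (D.sea_uniform f) fun g hg => ?_
    · show σ.wk.len * K + 1 ≤ _
      rw [Term.len_wk]
      omega
    · show σ.wk.len * K + 2 + r g ≤ _
      have := hA f g hg
      rw [Term.len_wk]
      omega
  have hm : ∀ {s} {t : Term L Γ s}, t.size r K = 0 →
      ¬ (t.wk (s' := .real)).Mentions fun _ x => σ.len * K + 1 + r f < x.weight r K := fun ht =>
    Term.not_mentions_of_size_eq_zero ((Term.size_wk _).trans ht) _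
  have heq : (Fml.eq (τ.wk (s' := .real)) (.start σ.wk)).Ready r K (σ.len * K + 1 + r f) := by
    refine ⟨hreg.1.1, trivial, ?_, Nat.zero_le _⟩
    simp only [Atom.Mentions, Term.Mentions, not_or]
    refine ⟨hm hs2, ?_, hm hs3⟩
    simp only [Term.weight, Term.len_wk]
    omega
  refine ⟨⟨heq, hreg.1.2, trivial, ?_, Nat.zero_le _⟩, heq, hsea⟩
  simp only [Atom.Mentions, Term.Mentions, not_or, not_exists]
  refine ⟨Nat.not_lt_zero _, ?_, fun s v => hm (sumArgs_eq_zero hs1 s v), hm hs3⟩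
  simp only [Term.weight, Term.len_wk]
  split <;> omega

/-- Lexicographic induction. Conditions on the new variable have a smaller bound `μ`, whatever their
size; the remaining atom has the same bound and a smaller size. -/
theorem exists_regr_atom (hr : ∀ f, r f + 2 ≤ K) (hK : 0 < K)
    (hA : ∀ f g, D.Above f g → r g < r f) (μ : ℕ) :
    ∀ {Γ : List Srt} (W : Atom L Γ), W.Ready r K μ → ∃ V, D.Regr (.atom W) V := by
  induction μ using Nat.strong_induction_on with
  | _ μ IH =>
  suffices h : ∀ (N : ℕ) {Γ : List Srt} (W : Atom L Γ), W.Ready r K μ → W.size r K = N →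
      ∃ V, D.Regr (.atom W) V from fun {_} W hW => h _ W hW rfl
  intro N
  induction N using Nat.strong_induction_on with
  | _ N ih =>
  intro Γ W hW hN
  have hless : ∀ {ν : ℕ} {Δ : List Srt} {φ : Fml L Δ}, φ.Ready r K ν → ν < μ → ∃ V, D.Regr φ V :=
    fun hφ hν => exists_regr_of_ready (IH _ hν) _ hφ
  -- Without weight in its terms the atom is final, or a relational fluent at a later situation,
  -- whose unfolding lowers `μ`.
  rcases Nat.eq_zero_or_pos (W.size r K) with h0 | hpos
  · have hterms : ¬ W.Mentions fun _ x => 0 < x.weight r K := fun hm =>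
      absurd (Atom.lt_size_of_mentions hm) (by omega)
    rcases Atom.uniform_or_rel hK W hW.regressable hW.notPoss hterms with hu | ⟨F, ts, α, σ, rfl⟩
    · exact ⟨_, .base W hu fun f hf => hterms (hf.mono fun _ _ hx => weight_pos_of_isTemp hx)⟩
    · have hw := hW.weight_le
      simp only [Atom.weight, Term.len, Nat.add_eq_zero_iff, one_ne_zero, and_false,
        if_false] at hw
      obtain ⟨V, hV⟩ := hless (relSSA_subst_ready (D := D) hr hK hW.regressable h0) hw
      exact ⟨V, .rel F ts α σ V hV⟩
  -- Since `u` is innermost, its size is its own weight, so its arguments are weightless.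
  · obtain ⟨s, u, hu, hwt, hsz⟩ := Atom.exists_innermost W hpos
    have hv : ¬ u.Mentions IsSitVar := fun h => hW.regressable.1 (hu.trans h)
    have hwμ : u.weight r K ≤ μ := by
      by_contra hlt
      exact hW.terms_le (hu.trans (Term.mentions_self (not_le.1 hlt)))
    have hrest : s ≠ .sit → ∃ V, D.Regr (.atom (W.wk.repl u.wk (hd : Term L (s :: Γ) s))) V :=
      fun hs => by
      refine ih _ ?_ _ (hW.wk.repl hs rfl (Term.not_isSitVar_hd hs)) rfl
      rw [← hN, ← Atom.size_wk (s' := s) W]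
      refine Atom.size_repl_lt hs (hwt.trans_eq (Term.weight_wk u).symm) rfl ?_
      rw [Atom.mentions_wk]
      exact hu.mono fun _ _ hx => Term.same_wk hx
    cases u with
    | fl f ts σ =>
      simp only [Term.Mentions, not_or, not_exists] at hv
      cases σ with
      | doAct α σ =>
        have hz : ¬ Term.Mentions (fun _ x => 0 < x.weight r K) (.doAct α σ) ∧
            ∀ s v, ¬ (ts s v).Mentions fun _ x => 0 < x.weight r K := by
          have hsz := hsz
          rw [Term.size, Nat.add_eq_left, Nat.add_eq_zero_iff] at hsz
          exact ⟨Term.not_mentions_of_size_eq_zero hsz.2 0,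
            fun s v => Term.not_mentions_of_size_eq_zero (sumArgs_eq_zero hsz.1 s v) 0⟩
        obtain ⟨V, hV⟩ := hless (funCond_ready (D := D) hr hK
          (by simp only [Term.Mentions, not_or, not_exists] at hv ⊢; exact hv) hsz) (by
            simp only [Term.weight, Term.len, Nat.add_eq_zero_iff, one_ne_zero, and_false,
              if_false] at hwμ
            exact hwμ)
        obtain ⟨V', hV'⟩ := hrest f.sort_ne_sit
        exact ⟨_, .func W hW.notPoss f ts α σ hu
          (fun s v => (Term.uniform_or_primeSit hK _ (hv.2.1 s v) (hz.2 s v)).1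
            fun hs => f.args_noSit (hs ▸ v.mem))
          ((Term.uniform_or_primeSit hK _ hv.2.2 hz.1).2 rfl) _
          (.ex _ _ _ (.and _ _ _ _ hV hV'))⟩
      | _ => exact absurd hwt (by simp [Term.weight, Term.len])
    | temp f ts τ σ =>
      obtain ⟨V, hV⟩ := hless (tempCond_ready (D := D) hA hv hsz) (by
        simp only [Term.weight] at hwμ
        omega)
      obtain ⟨V', hV'⟩ := hrest (by simp)
      exact ⟨_, .temp W hW.notPoss f ts τ σ hu _ (.ex _ _ _ (.and _ _ _ _ hV hV'))⟩
    | start σ =>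
      simp only [Term.Mentions, not_or] at hv
      cases σ with
      | doAct α σ =>
        simp only [Term.Mentions, not_or] at hv
        -- Rule 6 introduces no weight, because `α` lies inside an innermost term; `μ` stays and the
        -- size drops.
        have hα : (Term.time α).size r K = 0 := by
          rw [Term.size, Nat.add_eq_left] at hsz
          simp only [Term.size, Nat.add_eq_zero_iff] at hsz ⊢
          exact hsz.1
        obtain ⟨V, hV⟩ := ih _ (hN ▸ Atom.size_repl_lt (by simp) hwt hα hu) _
          (hW.repl (by simp) hα (by
            simp only [Term.Mentions, not_or]
            exact ⟨by simp [IsSitVar], hv.2.2.1⟩)) rfl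
        exact ⟨V, .start W hW.notPoss α σ hu V hV⟩
      | _ => exact absurd hwt (by simp [Term.weight, Term.len])
    | _ => exact absurd hwt (Nat.not_lt_zero _)

/-- The number of temporal fluents below a given one. -/
noncomputable def rank (D : TemporalBAT L) (f : L.TempFl) : ℕ :=
  {g | Relation.TransGen D.Above f g}.ncard

/-- What is below `g` is below `f`, and the inclusion is strict because `g` is below `f` but, by
stratification, not below itself. -/
theorem Stratified.rank_lt [Finite L.TempFl] (hD : D.Stratified) {f g : L.TempFl}
    (h : D.Above f g) : D.rank g < D.rank f :=
  Set.ncard_lt_ncard ⟨fun _ hx => Relation.TransGen.head h hx,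
    fun hsub => hD g (hsub (Relation.TransGen.single h))⟩

theorem rank_le [Finite L.TempFl] (f : L.TempFl) : D.rank f ≤ Nat.card L.TempFl :=
  Set.ncard_le_card _

/-- Every regressable formula has a regression. -/
theorem Stratified.exists_regr [Finite L.TempFl] (hD : D.Stratified) {Γ : List Srt} (φ : Fml L Γ)
    (hφ : φ.Regressable) : ∃ V, D.Regr φ V := by
  -- Ranks are at most the number of temporal fluents, so adding `2` to that number gives a
  -- sufficient `K`.
  have key : ∀ {Δ : List Srt} {φ : Fml L Δ} {μ : ℕ},
      φ.Ready D.rank (Nat.card L.TempFl + 2) μ → ∃ V, D.Regr φ V := fun {_} {φ} {_} h =>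
    exists_regr_of_ready (exists_regr_atom (fun f => Nat.add_le_add_right (rank_le f) 2)
      (Nat.succ_pos _) (fun _ _ => hD.rank_lt) _) φ h
  induction φ with
  | atom a =>
    by_cases hp : a.NotPoss
    · exact key (φ := .atom a) (Atom.ready_of_regressable hφ hp)
    · cases a with
      | poss α σ =>
        obtain ⟨A, ts, τ, rfl⟩ := hφ.2
        have h := hφ.1
        simp only [Atom.Mentions, Term.Mentions, not_or, not_exists] at h
        obtain ⟨μ, hμ⟩ := Fml.exists_ready_subst
          (r := D.rank) (K := Nat.card L.TempFl + 2)
          (Asg.cons_forall (p := fun _ t => ¬ Term.Mentions IsSitVar t) h.2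
            (Asg.cons_forall (p := fun _ t => ¬ Term.Mentions IsSitVar t) h.1.2.2 h.1.2.1))
          (D.pre_uniform A)
        obtain ⟨V, hV⟩ := key hμ
        exact ⟨V, .poss A ts τ σ V hV⟩
      | _ => exact absurd trivial hp
  | neg φ ih =>
    obtain ⟨V, hV⟩ := ih hφ
    exact ⟨_, .neg _ _ hV⟩
  | and φ ψ ih ih' =>
    obtain ⟨V, hV⟩ := ih hφ.1
    obtain ⟨V', hV'⟩ := ih' hφ.2
    exact ⟨_, .and _ _ _ _ hV hV'⟩
  | ex s φ ih =>
    obtain ⟨V, hV⟩ := ih hφ.2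
    exact ⟨_, .ex _ _ _ hV⟩

end TemporalBAT

end Existence

end SitCalc

theorem theorem3 (L : SitCalc.Signature) [Finite L.TempFl] (D : SitCalc.TemporalBAT L)
    (hD : D.Stratified) (W : SitCalc.Sentence L) (hW : W.Regressable) :
    (∃ V : SitCalc.Sentence L, D.Regr W V) ∧
      ∀ V : SitCalc.Sentence L, D.Regr W V →
        V.Uniform SitCalc.Term.S0 ∧ (∀ f : L.TempFl, ¬ V.MentionsTemp f) ∧
          (D.Entails W ↔ D.InitialEntails V) :=
  ⟨hD.exists_regr W hW, fun _ hV =>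
    ⟨(hV.uniform hW).1, (hV.uniform hW).2, hV.entails_iff hD hW⟩⟩
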